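/- Let $m,r\ge 1$, $\nu_1,\dots,\nu_m\in(0,1)$ and $\lambda_1,\dots,\lambda_m>0$. A stable subordinator of order $\nu$ is a process $H$ with values in $[0,\infty)$, $H(0)=0$, nondecreasing right-continuous paths and stationary independent increments such that $\mathbb E\,e^{-\mu H(t)}=e^{-t\mu^{\nu}}$ for $\mu,t\ge0$. Let ${}_kH_j$ ($1\le j\le m$, $1\le k\le r$) be independent, ${}_kH_j$ being a stable subordinator of order $\nu_j$. For weights $w_1,\dots,w_m>0$ put $$\mathfrak H(t)=\sum_{j=1}^m w_j\;{}_1H_j\big({}_2H_j(\cdots{}_rH_j(t)\cdots)\big),\qquad \mathfrak L(t)=\inf\{s>0:\mathfrak H(s)\ge t\},\qquad t>0 .$$ For $\alpha\in(0,1)$ let $\frac{\partial^{\alpha}}{\partial x^{\alpha}}f(x)=\frac1{\Gamma(1-\alpha)}\frac{d}{dx}\int_0^x\frac{f(s)}{(x-s)^{\alpha}}\,ds$ be the Riemann-Liouville derivative. Suppose that the weights $w_j$ and the coefficients $a_j$ are either $w_j=\lambda_j^{1/\nu_j^r}$, $a_j=\lambda_j$ for all $j$, or $w_j=\lambda_j^{1/\nu_j}$,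 $a_j=\lambda_j^{\nu_j^{r-1}}$ for all $j$ (the two choices agree when $r=1$). In both cases the following holds. (i) For every $t>0$ the law of $\mathfrak H(t)$ has a density $\mathfrak h(\cdot,t)$ on $(0,\infty)$, jointly continuous in $x,t>0$, which is a solution of $$\frac{\partial}{\partial t}\mathfrak h(x,t)=-\sum_{j=1}^m a_j\frac{\partial^{\nu_j^r}}{\partial x^{\nu_j^r}}\mathfrak h(x,t)\quad(x,t>0),\qquad \mathfrak h(x,0)=\delta(x),\qquad \mathfrak h(0,t)=0\quad(t>0),$$ where the initial condition means that $\int_0^\infty\varphi(x)\,\mathfrak h(x,t)\,dx\to\varphi(0)$ as $t\downarrow0$ for every bounded continuous $\varphi:\mathbb R\to\mathbb R$, and the boundary condition means that $\mathfrak h(x,t)\to0$ as $x\downarrow0$. (ii) For every $t>0$ the law of $\mathfrak L(t)$ has a density $\mathfrak l(\cdot,t)$ on $(0,\infty)$, jointly continuous in $x,t>0$, which is a solution of $$\sum_{j=1}^m a_j\frac{\partial^{\nu_j^r}}{\partial t^{\nu_j^r}}\mathfrak l(x,t)=-\frac{\partial}{\partial x}\mathfrak l(x,t)\quad(x,t>0),\qquad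 \mathfrak l(0,t)=\sum_{j=1}^m a_j\frac{t^{-\nu_j^r}}{\Gamma(1-\nu_j^r)}\quad(t>0),$$ where the boundary value is the limit as $x\downarrow0$. -/

import Mathlib

open Set Filter Topology MeasureTheory ProbabilityTheory
open scoped NNReal ENNReal BoundedContinuousFunction

/-- `H` is a stable subordinator of order `ν` (totally positively skewed stable process):
it starts at `0`, has nondecreasing right-continuous paths (almost surely), independent increments,
and the increment over `[s, t]` has Laplace transform `μ ↦ exp (-(t - s) μ ^ ν)`. -/
structure IsStableSubordinator {Ω : Type*} [MeasurableSpace Ω] (ν : ℝ) (H : ℝ≥0 → Ω → ℝ≥0)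
    (P : Measure Ω) : Prop where
  measurable : ∀ t, Measurable (H t)
  start_zero : ∀ᵐ ω ∂P, H 0 ω = 0
  monotone_paths : ∀ᵐ ω ∂P, Monotone (fun t => H t ω)
  rightCont_paths : ∀ᵐ ω ∂P, ∀ t, ContinuousWithinAt (fun s => H s ω) (Ici t) t
  indep_increments : HasIndepIncrements (fun t ω => (H t ω : ℝ)) P
  laplace_increments : ∀ s t : ℝ≥0, s ≤ t → ∀ μ : ℝ, 0 ≤ μ →
    ∫ ω, Real.exp (-μ * ((H t ω : ℝ) - (H s ω : ℝ))) ∂P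
      = Real.exp (-((t : ℝ) - (s : ℝ)) * μ ^ ν)

/-- The composition `t ↦ H₁ (H₂ (⋯ H_r (t) ⋯))` of `r` processes (`H₁` is the outermost one). -/
def iterComp {Ω : Type*} : (r : ℕ) → (Fin r → ℝ≥0 → Ω → ℝ≥0) → ℝ≥0 → Ω → ℝ≥0
  | 0, _, t, _ => t
  | r + 1, H, t, ω => H 0 (iterComp r (fun k => H k.succ) t ω) ω

/-- The process `t ↦ ∑ j, w j * H_{j,1} (H_{j,2} (⋯ H_{j,r} (t) ⋯))`. -/
noncomputable def combProcess {Ω : Type*} {m r : ℕ} (w : Fin m → ℝ)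
    (H : Fin m → Fin r → ℝ≥0 → Ω → ℝ≥0) (t : ℝ≥0) (ω : Ω) : ℝ :=
  ∑ j, w j * (iterComp r (H j) t ω : ℝ)

/-- The inverse (hitting time) `t ↦ inf {s > 0 : X s ≥ t}` of a process `X`. -/
noncomputable def inverseProcess {Ω : Type*} (X : ℝ≥0 → Ω → ℝ) (t : ℝ≥0) (ω : Ω) : ℝ :=
  ((sInf {s : ℝ≥0 | 0 < s ∧ (t : ℝ) ≤ X s ω} : ℝ≥0) : ℝ)

/-- For every `t > 0` the law of `X t` is carried by `(0, ∞)` and has there the density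
`x ↦ u x t`; the version `u` of the density is jointly continuous in `x > 0`, `t > 0`. -/
def IsLawDensity {Ω : Type*} [MeasurableSpace Ω] (P : Measure Ω) (X : ℝ≥0 → Ω → ℝ)
    (u : ℝ → ℝ → ℝ) : Prop :=
  ContinuousOn (fun p : ℝ × ℝ => u p.1 p.2) (Ioi 0 ×ˢ Ioi 0) ∧
  ∀ t : ℝ≥0, 0 < t → AEMeasurable (X t) P ∧ (∀ x > 0, 0 ≤ u x t) ∧
    P.map (X t) = (volume.restrict (Ioi 0)).withDensity (fun x => ENNReal.ofReal (u x t))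

/-- `f` has at `x` the Riemann-Liouville derivative `d` of order `α ∈ (0, 1)`:
`d = (1 / Γ(1 - α)) (d/dx) ∫₀ˣ f(s) (x - s)^(-α) ds`, where the integrals converge near `x`. -/
def HasRLDerivAt (α : ℝ) (f : ℝ → ℝ) (d x : ℝ) : Prop :=
  (∀ᶠ y in 𝓝 x, IntegrableOn (fun s => f s / (y - s) ^ α) (Ioo 0 y)) ∧
  HasDerivAt (fun y => (1 / Real.Gamma (1 - α)) * ∫ s in Ioo 0 y, f s / (y - s) ^ α) d x

/-- `h` solves `∂ₜ h = - ∑ j, a j ∂ₓ^{α j} h` for `x > 0`, `t > 0`, with `h(x, 0) = δ(x)`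
(weak convergence as `t ↓ 0`) and `h(0, t) = 0` (limit as `x ↓ 0`). -/
def SolvesSpaceFractional {m : ℕ} (a α : Fin m → ℝ) (h : ℝ → ℝ → ℝ) : Prop :=
  (∀ x > 0, ∀ t > 0, ∃ d : Fin m → ℝ,
    (∀ j, HasRLDerivAt (α j) (fun y => h y t) (d j) x) ∧
    HasDerivAt (fun τ => h x τ) (-∑ j, a j * d j) t) ∧
  (∀ φ : ℝ →ᵇ ℝ, Tendsto (fun t => ∫ x in Ioi 0, φ x * h x t) (𝓝[>] 0) (𝓝 (φ 0))) ∧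
  (∀ t > 0, Tendsto (fun x => h x t) (𝓝[>] 0) (𝓝 0))

/-- `l` solves `∑ j, a j ∂ₜ^{α j} l = - ∂ₓ l` for `x > 0`, `t > 0`, with
`l(0, t) = ∑ j, a j t^{-α j} / Γ(1 - α j)` (limit as `x ↓ 0`). -/
def SolvesTimeFractional {m : ℕ} (a α : Fin m → ℝ) (l : ℝ → ℝ → ℝ) : Prop :=
  (∀ x > 0, ∀ t > 0, ∃ d : Fin m → ℝ,
    (∀ j, HasRLDerivAt (α j) (fun τ => l x τ) (d j) t) ∧
    HasDerivAt (fun y => l y t) (-∑ j, a j * d j) x) ∧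
  (∀ t > 0, Tendsto (fun x => l x t) (𝓝[>] 0)
    (𝓝 (∑ j, a j * (t ^ (-(α j)) / Real.Gamma (1 - α j)))))

/-! Everything follows from one Laplace transform. For a subordinator `Z` of order `ν` and an
independent time `Y`, `E exp(-s Z(Y)) = E exp(-s^ν Y)`. Hence the `r`-fold composition at time `t`
has transform `exp(-t s^(ν^r))`, and by independence the weighted sum has `exp(-t Φ(s))` with `Φ(s)
= ∑ a_j s^(α_j)`, `α_j = ν_j^r`, `a_j = w_j^(α_j)`. Both choices of weights satisfy this last
relation. `HasLaplaceExponent` isolates what is used afterwards: this transform and monotone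
right-continuous paths from `0`.

Since `α_j < 1`, `Re Φ(s) ≥ κ ∑ a_j |s|^(α_j)` for `Re s > 0` (`exists_le_re_laplaceExponent`). So
on `Re s = 1` the factor `exp(-tΦ)` beats all powers of `|s|`, and `B_G(x,t) = (1/2πi) ∫ exp(xs -
tΦ(s)) G(s) ds` converges for every `G` of polynomial growth. Then `∂_x` replaces `G` by `sG`, `∂_t`
replaces it by `-ΦG`, and convolution with `u^(b-1)` on `u > 0` replaces it by `Γ(b) s^(-b) G`. If
`Re B_G` vanishes for `x ≤ 0`, the Riemann-Liouville derivative of order `γ` therefore replaces `G`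
by `s^γ G`.

Fourier inversion of the law tilted by `exp(-x)` gives `h = Re B_1`, zero for `x ≤ 0`
(`eq_withDensity_re_bromwich`). The space-fractional equation is then the identity `Φ = ∑ a_j
s^(α_j)`. For the inverse, `P(L(t) ≤ x) = P(X(x) ≥ t) = 1 - Re B_{1/s}(t,x)`. Differentiating in `x`
gives `l(x,t) = Re B_{Φ/s}(t,x)`, to which the same calculus applies with the roles of the variables
exchanged. The delicate point is the limit of `l` as `x ↓ 0`, where the decay of `exp(-xΦ)` is lost
(`tendsto_re_bromwich_nhdsGT_zero`). -/

/-! ### Laplace transforms in the right half-plane -/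

/-- A Laplace transform which agrees on the positive reals with an analytic function agrees with it
on the right half-plane. -/
theorem integral_cexp_neg_mul_eq_of_real {μ : Measure ℝ} {F : ℂ → ℂ}
    (hF : AnalyticOnNhd ℂ F {z | 0 < z.re})
    (hint : ∀ s : ℝ, 0 < s → Integrable (fun x => Real.exp (-s * x)) μ)
    (heq : ∀ s : ℝ, 0 < s → ((∫ x, Real.exp (-s * x) ∂μ : ℝ) : ℂ) = F s)
    {z : ℂ} (hz : 0 < z.re) : ∫ x, Complex.exp (-z * x) ∂μ = F z := by
  have hsub : Ioi (0 : ℝ) ⊆ interior (integrableExpSet (fun x : ℝ => -x) μ) := by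
    rw [isOpen_Ioi.subset_interior_iff]
    intro s hs
    simpa [integrableExpSet] using hint s hs
  have h1 : AnalyticOnNhd ℂ (complexMGF (fun x : ℝ => -x) μ) {z | 0 < z.re} :=
    analyticOnNhd_complexMGF.mono fun z hz => hsub hz
  -- Identity theorem on the half-plane: agreement at real points accumulating at `1` suffices.
  have h2 := AnalyticOnNhd.eqOn_of_preconnected_of_frequently_eq h1 hF
    ((convex_Ioi (0 : ℝ)).linear_preimage Complex.reLm).isPreconnected
    (z₀ := ((1 : ℝ) : ℂ)) (by simp) (by
      have h_real : ∃ᶠ (x : ℝ) in 𝓝[≠] 1, complexMGF (fun x : ℝ => -x) μ x = F x := by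
        refine Eventually.frequently ?_
        filter_upwards [mem_nhdsWithin_of_mem_nhds (Ioi_mem_nhds one_pos)] with s hs
        rw [complexMGF_ofReal, ← heq s hs, mgf]
        simp
      rw [frequently_iff_seq_forall] at h_real ⊢
      obtain ⟨xs, hx, hx_eq⟩ := h_real
      refine ⟨fun n => xs n, ?_, fun n => hx_eq n⟩
      rw [tendsto_nhdsWithin_iff] at hx ⊢
      exact ⟨(Complex.continuous_ofReal.tendsto _).comp hx.1, by simpa using hx.2⟩)
  have h3 := h2 hz
  rw [← h3, complexMGF]
  simp

/-- The Laplace transform of `u ^ (b - 1)` in the right half-plane. -/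
theorem integral_rpow_mul_cexp_neg_mul {b : ℝ} (hb : 0 < b) {z : ℂ} (hz : 0 < z.re) :
    ∫ u in Ioi (0 : ℝ), ((u ^ (b - 1) : ℝ) : ℂ) * Complex.exp (-z * u)
      = Real.Gamma b * z ^ (-b : ℂ) := by
  have hm : Measurable fun u : ℝ => Real.toNNReal (u ^ (b - 1)) := by fun_prop
  have key := integral_cexp_neg_mul_eq_of_real
    (μ := (volume.restrict (Ioi (0 : ℝ))).withDensity fun u => (Real.toNNReal (u ^ (b - 1)) : ℝ≥0∞))
    (F := fun z => Real.Gamma b * z ^ (-b : ℂ)) ?_ ?_ ?_ hz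
  · rw [← key, integral_withDensity_eq_integral_smul hm]
    refine setIntegral_congr_fun measurableSet_Ioi fun u hu => ?_
    have : 0 ≤ u ^ (b - 1) := Real.rpow_nonneg (le_of_lt hu) _
    simp [NNReal.smul_def, this]
  · intro z hz
    refine (analyticAt_const.mul ?_)
    exact analyticAt_id.cpow analyticAt_const (Or.inl hz)
  · intro s hs
    rw [integrable_withDensity_iff_integrable_smul hm]
    have := integrableOn_rpow_mul_exp_neg_mul_rpow (s := b - 1) (p := 1) (b := s) (by linarith)
      one_pos hs
    refine IntegrableOn.congr_fun this (fun u hu => ?_) measurableSet_Ioi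
    have : 0 ≤ u ^ (b - 1) := Real.rpow_nonneg (le_of_lt hu) _
    simp [NNReal.smul_def, this]
  · intro s hs
    rw [integral_withDensity_eq_integral_smul hm]
    have := Real.integral_rpow_mul_exp_neg_mul_Ioi hb hs
    rw [← setIntegral_congr_fun (f := fun u : ℝ => u ^ (b - 1) * Real.exp (-(s * u)))
      measurableSet_Ioi, this]
    · rw [one_div, Real.inv_rpow hs.le, ← Real.rpow_neg hs.le]
      push_cast [Complex.ofReal_cpow hs.le]
      ring
    · intro u hu
      have : 0 ≤ u ^ (b - 1) := Real.rpow_nonneg (le_of_lt hu) _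
      simp [NNReal.smul_def, this]

/-! ### Fourier inversion for finite measures on the line -/

/-- The candidate density of a measure with integrable characteristic function `ψ`. -/
noncomputable def inverseCharFun (ψ : ℝ → ℂ) (x : ℝ) : ℂ :=
  (2 * Real.pi)⁻¹ * ∫ y : ℝ, Complex.exp (-(y * x * Complex.I)) * ψ y

/-- The Fourier transform is moved across the pairing twice: from `ν` to the inverse transform of
`φ`, and from `φ` to `charFun ν`. Up to `ξ ↦ -ξ` both sides become the integral of `charFun ν (2πξ)`
against that inverse transform. -/
theorem integral_eq_integral_mul_inverseCharFun {ν : Measure ℝ} [IsFiniteMeasure ν]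
    (hν : Integrable (charFun ν)) (φ : SchwartzMap ℝ ℂ) :
    ∫ x, φ x ∂ν = ∫ x, φ x * inverseCharFun (charFun ν) x := by
  have hpi : (2 * Real.pi) ≠ 0 := by positivity
  have hψ : Integrable fun ξ : ℝ => charFun ν (2 * Real.pi * ξ) := hν.comp_mul_left' hpi
  have h1 := VectorFourier.integral_fourierIntegral_smul_eq_flip (L := innerₗ ℝ) (μ := ν)
    (ν := volume) (f := fun _ => (1 : ℂ)) (g := (FourierTransform.fourierInv φ : SchwartzMap ℝ ℂ))
    Real.continuous_fourierChar continuous_inner (integrable_const _) (SchwartzMap.integrable _)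
  have h2 := VectorFourier.integral_fourierIntegral_smul_eq_flip (L := innerₗ ℝ) (μ := volume)
    (ν := volume) (f := (φ : ℝ → ℂ)) (g := fun ξ : ℝ => charFun ν (2 * Real.pi * ξ))
    Real.continuous_fourierChar continuous_inner φ.integrable hψ
  have e1 : ∀ x, VectorFourier.fourierIntegral Real.fourierChar volume (innerₗ ℝ).flip
      (FourierTransform.fourierInv φ : SchwartzMap ℝ ℂ) x = φ x := by
    intro x
    have : (FourierTransform.fourier (FourierTransform.fourierInv φ : SchwartzMap ℝ ℂ)) x
        = φ x := by
      rw [FourierTransform.fourier_fourierInv_eq]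
    rw [← this, SchwartzMap.fourier_coe, flip_innerₗ]
    rfl
  have e2 : ∀ ξ, VectorFourier.fourierIntegral Real.fourierChar ν (innerₗ ℝ) (fun _ => (1 : ℂ)) ξ
      = charFun ν (2 * Real.pi * (-ξ)) := by
    intro ξ
    rw [charFun_eq_fourierIntegral']
    congr 1
    simp only [smul_eq_mul]
    field_simp
  have e3 : ∀ ξ, VectorFourier.fourierIntegral Real.fourierChar volume (innerₗ ℝ) φ ξ
      = (FourierTransform.fourierInv φ : SchwartzMap ℝ ℂ) (-ξ) := by
    intro ξ
    rw [SchwartzMap.fourierInv_coe, Real.fourierInv_eq_fourier_neg, neg_neg]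
    rfl
  have e4 : ∀ x, VectorFourier.fourierIntegral Real.fourierChar volume (innerₗ ℝ).flip
      (fun ξ : ℝ => charFun ν (2 * Real.pi * ξ)) x = inverseCharFun (charFun ν) x := by
    intro x
    rw [flip_innerₗ, inverseCharFun]
    have := Measure.integral_comp_mul_left
      (fun y : ℝ => Complex.exp (-(y * x * Complex.I)) * charFun ν y) (2 * Real.pi)
    rw [abs_of_pos (by positivity)] at this
    rw [VectorFourier.fourierIntegral]
    have h : ∀ y : ℝ, Real.fourierChar (-((innerₗ ℝ) y) x) • charFun ν (2 * Real.pi * y)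
      = Complex.exp (-(((2 * Real.pi * y : ℝ) : ℂ) * x * Complex.I)) * charFun ν (2 * Real.pi * y) := by
      intro y
      rw [Circle.smul_def, Real.fourierChar_apply, smul_eq_mul]
      congr 2
      simp
      ring
    simp_rw [h]
    rw [this, Complex.real_smul]
  simp_rw [e1, e2, smul_eq_mul, one_mul] at h1
  simp_rw [e3, e4, smul_eq_mul] at h2
  rw [← h1, ← h2, ← integral_neg_eq_self]
  refine integral_congr_ae (.of_forall fun ξ => ?_)
  simp [mul_comm]

theorem continuous_inverseCharFun {ψ : ℝ → ℂ} (hψ : Integrable ψ) :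
    Continuous (inverseCharFun ψ) := by
  refine continuous_const.mul (continuous_of_dominated (bound := fun y => ‖ψ y‖) ?_ ?_ hψ.norm ?_)
  · intro x
    exact (Continuous.aestronglyMeasurable (by fun_prop)).mul hψ.aestronglyMeasurable
  · intro x
    refine .of_forall fun y => ?_
    rw [norm_mul, Complex.norm_exp]
    simp
  · exact .of_forall fun y => by fun_prop

/-- Lévy inversion for measures with integrable characteristic function. -/
theorem measureReal_Icc_eq_integral_inverseCharFun {ν : Measure ℝ} [IsFiniteMeasure ν]
    (hν : Integrable (charFun ν)) {a b : ℝ} (hab : a ≤ b) :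
    ν.real (Icc a b) = ∫ x in Icc a b, (inverseCharFun (charFun ν) x).re := by
  set c := (a + b) / 2 with hc
  set ρ := (b - a) / 2 with hρ
  have hρ0 : 0 ≤ ρ := by rw [hρ]; linarith
  have hcl : Icc a b = Metric.closedBall c ρ := by
    rw [Real.closedBall_eq_Icc]; congr 1 <;> rw [hc, hρ] <;> ring
  -- Smooth bumps equal to `1` on a ball slightly larger than `[a, b]`, with supports shrinking to
  -- it: they converge pointwise to the indicator of the closed interval. The margin keeps the inner
  -- radius positive even when `a = b`.
  let f : ℕ → ContDiffBump c := fun n => ⟨ρ + 1 / (n + 1) / 2, ρ + 1 / (n + 1), by positivity, by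
    have : (0 : ℝ) < 1 / (n + 1) := by positivity
    linarith⟩
  have hcont : Continuous (inverseCharFun (charFun ν)) := continuous_inverseCharFun hν
  have hbound : ∀ n x, ‖f n x‖ ≤ (Metric.closedBall c (ρ + 1)).indicator (fun _ => (1 : ℝ)) x := by
    intro n x
    rw [Real.norm_of_nonneg (f n).nonneg]
    by_cases hx : x ∈ Metric.closedBall c (ρ + 1)
    · rw [indicator_of_mem hx]; exact (f n).le_one
    · rw [indicator_of_notMem hx, (f n).zero_of_le_dist]
      have h1 : ρ + 1 < dist x c := by simpa using hx
      have h2 : (1 : ℝ) / (n + 1) ≤ 1 := by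
        rw [div_le_one (by positivity)]; linarith [(Nat.cast_nonneg n : (0 : ℝ) ≤ n)]
      change ρ + 1 / ((n : ℝ) + 1) ≤ _
      linarith
  have hlim : ∀ x, Tendsto (fun n => f n x) atTop (𝓝 ((Icc a b).indicator (fun _ => (1 : ℝ)) x)) := by
    intro x
    by_cases hx : x ∈ Icc a b
    · rw [indicator_of_mem hx]
      rw [hcl] at hx
      exact tendsto_const_nhds.congr fun n => ((f n).one_of_mem_closedBall
        (Metric.closedBall_subset_closedBall (le_add_of_nonneg_right (by positivity)) hx)).symm
    · rw [indicator_of_notMem hx]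
      have h1 : ρ < dist x c := by rw [hcl] at hx; simpa using hx
      refine tendsto_const_nhds.congr' ?_
      have := (tendsto_one_div_add_atTop_nhds_zero_nat (𝕜 := ℝ)).eventually
        (gt_mem_nhds (sub_pos.2 h1))
      filter_upwards [this] with n hn
      rw [(f n).zero_of_le_dist]
      change ρ + 1 / ((n : ℝ) + 1) ≤ _
      linarith
  have hid : ∀ n, ∫ x, f n x ∂ν = ∫ x, f n x * (inverseCharFun (charFun ν) x).re := by
    intro n
    have hs : HasCompactSupport fun x => ((f n x : ℝ) : ℂ) :=
      (f n).hasCompactSupport.comp_left (g := fun r : ℝ => (r : ℂ)) rfl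
    have hi : Integrable fun x => ((f n x : ℝ) : ℂ) * inverseCharFun (charFun ν) x :=
      Continuous.integrable_of_hasCompactSupport
        ((Complex.continuous_ofReal.comp (f n).continuous).mul hcont) hs.mul_right
    have h : ∫ x, ((f n x : ℝ) : ℂ) ∂ν = ∫ x, ((f n x : ℝ) : ℂ) * inverseCharFun (charFun ν) x :=
      integral_eq_integral_mul_inverseCharFun hν
        (hs.toSchwartzMap (Complex.ofRealCLM.contDiff.comp (f n).contDiff))
    have hre : ∫ x, (((f n x : ℝ) : ℂ) * inverseCharFun (charFun ν) x).re
        = (∫ x, ((f n x : ℝ) : ℂ) * inverseCharFun (charFun ν) x).re := integral_re hi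
    simp only [Complex.re_ofReal_mul] at hre
    rw [hre, ← h, integral_complex_ofReal, Complex.ofReal_re]
  have l1 : Tendsto (fun n => ∫ x, f n x ∂ν) atTop
      (𝓝 (∫ x, (Icc a b).indicator (fun _ => (1 : ℝ)) x ∂ν)) := by
    refine tendsto_integral_of_dominated_convergence _
      (fun n => (f n).continuous.aestronglyMeasurable) ?_ (fun n => .of_forall (hbound n))
      (.of_forall hlim)
    exact (integrable_const _).indicator Metric.isClosed_closedBall.measurableSet
  have l2 : Tendsto (fun n => ∫ x, f n x * (inverseCharFun (charFun ν) x).re) atTop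
      (𝓝 (∫ x, (Icc a b).indicator (fun _ => (1 : ℝ)) x * (inverseCharFun (charFun ν) x).re)) := by
    refine tendsto_integral_of_dominated_convergence
      (fun x => (Metric.closedBall c (ρ + 1)).indicator
        (fun x => |(inverseCharFun (charFun ν) x).re|) x) (fun n => ?_) ?_
      (fun n => .of_forall fun x => ?_) (.of_forall fun x => (hlim x).mul_const _)
    · exact Continuous.aestronglyMeasurable ((f n).continuous.mul (Complex.continuous_re.comp hcont))
    · rw [integrable_indicator_iff Metric.isClosed_closedBall.measurableSet]
      exact ContinuousOn.integrableOn_compact (isCompact_closedBall _ _)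
        (Complex.continuous_re.comp hcont).abs.continuousOn
    · rw [norm_mul, Real.norm_eq_abs (Complex.re _)]
      refine (mul_le_mul_of_nonneg_right (hbound n x) (abs_nonneg _)).trans (le_of_eq ?_)
      by_cases hx : x ∈ Metric.closedBall c (ρ + 1) <;> simp [hx]
  have e := tendsto_nhds_unique (l1.congr hid) l2
  rw [integral_indicator_const _ measurableSet_Icc, smul_eq_mul, mul_one] at e
  rw [e, ← integral_indicator measurableSet_Icc]
  congr with x
  by_cases hx : x ∈ Icc a b <;> simp [hx]

/-! ### The Bromwich line and functions of polynomial growth on it -/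

/-- The parametrization `y ↦ 1 + i y` of the Bromwich line. -/
noncomputable def bromwichLine (y : ℝ) : ℂ := 1 + y * Complex.I

@[simp] lemma bromwichLine_re (y : ℝ) : (bromwichLine y).re = 1 := by simp [bromwichLine]

@[simp] lemma bromwichLine_im (y : ℝ) : (bromwichLine y).im = y := by simp [bromwichLine]

lemma bromwichLine_re_pos (y : ℝ) : 0 < (bromwichLine y).re := by simp

lemma bromwichLine_ne_zero (y : ℝ) : bromwichLine y ≠ 0 := fun h => by
  simpa using congrArg Complex.re h

lemma norm_bromwichLine_sq (y : ℝ) : ‖bromwichLine y‖ ^ 2 = 1 + y ^ 2 := by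
  rw [← Complex.normSq_eq_norm_sq, Complex.normSq_apply]
  simp [sq]

lemma one_le_norm_bromwichLine (y : ℝ) : 1 ≤ ‖bromwichLine y‖ := by
  have := Complex.abs_re_le_norm (bromwichLine y)
  simpa using this

@[fun_prop] lemma continuous_bromwichLine : Continuous bromwichLine := by
  unfold bromwichLine; fun_prop

lemma hasDerivAt_bromwichLine (y : ℝ) : HasDerivAt bromwichLine Complex.I y := by
  unfold bromwichLine
  simpa using ((Complex.ofRealCLM.hasDerivAt (x := y)).mul_const Complex.I).const_add 1

/-- The Laplace exponent `∑ j, a j * s ^ α j`. -/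
noncomputable def laplaceExponent {m : ℕ} (a α : Fin m → ℝ) (s : ℂ) : ℂ :=
  ∑ j, (a j : ℂ) * s ^ (α j : ℂ)

/-- Functions which are continuous in the right half-plane and of polynomial growth on the
Bromwich line. -/
def IsTame (G : ℂ → ℂ) : Prop :=
  ContinuousOn G {s | 0 < s.re} ∧
    ∃ (C : ℝ) (N : ℕ), ∀ y, ‖G (bromwichLine y)‖ ≤ C * ‖bromwichLine y‖ ^ N

lemma IsTame.continuous {G : ℂ → ℂ} (hG : IsTame G) : Continuous fun y => G (bromwichLine y) :=
  hG.1.comp_continuous continuous_bromwichLine bromwichLine_re_pos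

lemma isTame_const (c : ℂ) : IsTame fun _ => c :=
  ⟨continuousOn_const, ‖c‖, 0, fun y => by simp⟩

lemma isTame_cpow (b : ℝ) : IsTame fun s => s ^ (b : ℂ) := by
  refine ⟨fun s hs => (continuousAt_id.cpow continuousAt_const (Or.inl hs)).continuousWithinAt,
    1, ⌈b⌉₊, fun y => ?_⟩
  rw [Complex.norm_cpow_real, one_mul, ← Real.rpow_natCast]
  exact Real.rpow_le_rpow_of_exponent_le (one_le_norm_bromwichLine y) (Nat.le_ceil b)

lemma isTame_id : IsTame fun s => s :=
  ⟨continuousOn_id, 1, 1, fun y => by simp⟩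

lemma IsTame.mul {F G : ℂ → ℂ} (hF : IsTame F) (hG : IsTame G) : IsTame fun s => F s * G s := by
  obtain ⟨C, N, hC⟩ := hF.2
  obtain ⟨D, M, hD⟩ := hG.2
  refine ⟨hF.1.mul hG.1, C * D, N + M, fun y => ?_⟩
  rw [norm_mul]
  calc _ ≤ (C * ‖bromwichLine y‖ ^ N) * (D * ‖bromwichLine y‖ ^ M) :=
        mul_le_mul (hC y) (hD y) (norm_nonneg _) ((norm_nonneg _).trans (hC y))
    _ = _ := by ring

lemma IsTame.add {F G : ℂ → ℂ} (hF : IsTame F) (hG : IsTame G) : IsTame fun s => F s + G s := by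
  obtain ⟨C, N, hC⟩ := hF.2
  obtain ⟨D, M, hD⟩ := hG.2
  refine ⟨hF.1.add hG.1, |C| + |D|, N + M, fun y => (norm_add_le _ _).trans ?_⟩
  have h1 := one_le_norm_bromwichLine y
  calc _ ≤ |C| * ‖bromwichLine y‖ ^ (N + M) + |D| * ‖bromwichLine y‖ ^ (N + M) := by
        refine add_le_add ((hC y).trans ?_) ((hD y).trans ?_)
        · exact mul_le_mul (le_abs_self _) (pow_le_pow_right₀ h1 (by omega)) (by positivity)
            (abs_nonneg _)
        · exact mul_le_mul (le_abs_self _) (pow_le_pow_right₀ h1 (by omega)) (by positivity)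
            (abs_nonneg _)
    _ = _ := by ring

lemma isTame_sum {ι : Type*} (S : Finset ι) {F : ι → ℂ → ℂ} (hF : ∀ i, IsTame (F i)) :
    IsTame fun s => ∑ i ∈ S, F i s := by
  classical
  induction S using Finset.induction_on with
  | empty => simpa using isTame_const 0
  | insert i S hi ih => simpa [Finset.sum_insert hi] using (hF i).add ih

lemma isTame_laplaceExponent {m : ℕ} (a α : Fin m → ℝ) : IsTame (laplaceExponent a α) :=
  isTame_sum _ fun j => (isTame_const _).mul (isTame_cpow (α j))

/-- The inverse Laplace transform of `exp (-t Φ) G`, `Φ` being the Laplace exponent. -/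
noncomputable def bromwich {m : ℕ} (a α : Fin m → ℝ) (G : ℂ → ℂ) (x t : ℝ) : ℂ :=
  (2 * Real.pi)⁻¹ * ∫ y : ℝ, Complex.exp (x * bromwichLine y
    - t * laplaceExponent a α (bromwichLine y)) * G (bromwichLine y)

/-- `exp (-c r ^ β)` beats every power of `r ≥ 1`. -/
lemma exists_pow_mul_exp_neg_rpow_le {c β : ℝ} (hc : 0 < c) (hβ : 0 < β) (N : ℕ) :
    ∃ K : ℝ, ∀ r : ℝ, 1 ≤ r → r ^ N * Real.exp (-c * r ^ β) ≤ K := by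
  -- With this `M`, `r^N ≤ (r^β)^M`, and `u^M / M! ≤ exp u` is applied at `u = c r^β`.
  set M := ⌈N / β⌉₊ with hM
  refine ⟨M.factorial / c ^ M, fun r hr => ?_⟩
  have hr0 : 0 < r := by linarith
  have hu : 1 ≤ r ^ β := Real.one_le_rpow hr hβ.le
  have h1 : r ^ N ≤ (r ^ β) ^ M := by
    rw [← Real.rpow_natCast, ← Real.rpow_natCast, ← Real.rpow_mul hr0.le]
    refine Real.rpow_le_rpow_of_exponent_le hr ?_
    have := Nat.le_ceil (N / β)
    rw [div_le_iff₀ hβ] at this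
    linarith
  have h2 := Real.pow_div_factorial_le_exp (c * r ^ β) (by positivity) M
  rw [div_le_iff₀ (by positivity)] at h2
  rw [neg_mul, Real.exp_neg, ← div_eq_mul_inv, div_le_div_iff₀ (Real.exp_pos _) (by positivity)]
  calc r ^ N * c ^ M ≤ (r ^ β) ^ M * c ^ M := by gcongr
    _ = (c * r ^ β) ^ M := by ring
    _ ≤ _ := by linarith

/-! ### Bromwich integrals: decay, differentiation, convolution with powers -/

section

variable {m : ℕ} {a α : Fin m → ℝ}

/-- On the right half-plane the real part of the exponent dominates its modulus. -/
lemma exists_le_re_laplaceExponent (ha : ∀ j, 0 < a j) (hα : ∀ j, α j ∈ Ioo (0 : ℝ) 1) :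
    ∃ κ : ℝ, 0 < κ ∧ ∀ s : ℂ, 0 < s.re →
      κ * ∑ j, a j * ‖s‖ ^ α j ≤ (laplaceExponent a α s).re := by
  -- The argument of `s` stays within `π/2` in modulus, so the angle of `s ^ α j` is at most `α j
  -- π/2 < π/2`; `κ` is the least of the resulting cosines.
  obtain ⟨κ, hκ, hle⟩ : ∃ κ : ℝ, 0 < κ ∧ ∀ j, κ ≤ Real.cos (α j * (Real.pi / 2)) := by
    rcases isEmpty_or_nonempty (Fin m) with h | h
    · exact ⟨1, one_pos, fun j => h.elim j⟩
    · obtain ⟨i, hi⟩ := Finite.exists_min fun j => Real.cos (α j * (Real.pi / 2))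
      refine ⟨_, Real.cos_pos_of_mem_Ioo ⟨?_, ?_⟩, hi⟩
      · nlinarith [(hα i).1, Real.pi_pos]
      · nlinarith [(hα i).2, Real.pi_pos]
  refine ⟨κ, hκ, fun s hs => ?_⟩
  rw [laplaceExponent, Complex.re_sum, Finset.mul_sum]
  refine Finset.sum_le_sum fun j _ => ?_
  rw [Complex.re_ofReal_mul, Complex.cpow_ofReal_re]
  have harg : |Complex.arg s| ≤ Real.pi / 2 := (Complex.abs_arg_lt_pi_div_two_iff.2 (Or.inl hs)).le
  have hcos : κ ≤ Real.cos (Complex.arg s * α j) := by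
    refine (hle j).trans ?_
    rw [← Real.cos_abs (Complex.arg s * α j), abs_mul, abs_of_pos (hα j).1, mul_comm (|_|)]
    refine Real.cos_le_cos_of_nonneg_of_le_pi ?_ ?_ ?_
    · exact mul_nonneg (hα j).1.le (abs_nonneg _)
    · nlinarith [(hα j).2, (hα j).1, Real.pi_pos]
    · exact mul_le_mul_of_nonneg_left harg (hα j).1.le
  have : 0 ≤ a j * ‖s‖ ^ α j := mul_nonneg (ha j).le (Real.rpow_nonneg (norm_nonneg _) _)
  nlinarith

lemma norm_laplaceExponent_le (ha : ∀ j, 0 < a j) (s : ℂ) :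
    ‖laplaceExponent a α s‖ ≤ ∑ j, a j * ‖s‖ ^ α j := by
  refine (norm_sum_le _ _).trans (Finset.sum_le_sum fun j _ => ?_)
  rw [norm_mul, Complex.norm_cpow_real, Complex.norm_real, Real.norm_of_nonneg (ha j).le]

lemma re_laplaceExponent_nonneg (ha : ∀ j, 0 < a j) (hα : ∀ j, α j ∈ Ioo (0 : ℝ) 1) {s : ℂ}
    (hs : 0 < s.re) : 0 ≤ (laplaceExponent a α s).re := by
  obtain ⟨κ, hκ, h⟩ := exists_le_re_laplaceExponent ha hα
  refine le_trans (mul_nonneg hκ.le (Finset.sum_nonneg fun j _ => ?_)) (h s hs)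
  exact mul_nonneg (ha j).le (Real.rpow_nonneg (norm_nonneg _) _)

/-- The common dominating function for continuity and for both differentiations under the integral.
One summand of the exponent already supplies the decay. Of the `N + 2` powers absorbed, `N` pay for
`G` and two produce the integrable factor `(1 + y^2)⁻¹`. -/
lemma exists_norm_bromwich_integrand_le (hm : 1 ≤ m) (ha : ∀ j, 0 < a j)
    (hα : ∀ j, α j ∈ Ioo (0 : ℝ) 1) {G : ℂ → ℂ} (hG : IsTame G) (X : ℝ) {t₀ : ℝ} (ht₀ : 0 < t₀) :
    ∃ K : ℝ, ∀ x ≤ X, ∀ t ≥ t₀, ∀ y : ℝ, ‖Complex.exp (x * bromwichLine y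
      - t * laplaceExponent a α (bromwichLine y)) * G (bromwichLine y)‖ ≤ K * (1 + y ^ 2)⁻¹ := by
  obtain ⟨κ, hκ, hre⟩ := exists_le_re_laplaceExponent ha hα
  obtain ⟨C, N, hC⟩ := hG.2
  let i : Fin m := ⟨0, hm⟩
  obtain ⟨K, hK⟩ := exists_pow_mul_exp_neg_rpow_le (c := t₀ * (κ * a i)) (β := α i)
    (mul_pos ht₀ (mul_pos hκ (ha i))) (hα i).1 (N + 2)
  refine ⟨Real.exp X * (|C| * K), fun x hx t ht y => ?_⟩
  set s := bromwichLine y with hs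
  have hs1 : 1 ≤ ‖s‖ := one_le_norm_bromwichLine y
  have hΦ : κ * a i * ‖s‖ ^ α i ≤ (laplaceExponent a α s).re := by
    refine le_trans ?_ (hre s (bromwichLine_re_pos y))
    rw [mul_assoc]
    refine mul_le_mul_of_nonneg_left ?_ hκ.le
    exact Finset.single_le_sum (f := fun j => a j * ‖s‖ ^ α j)
      (fun j _ => mul_nonneg (ha j).le (Real.rpow_nonneg (norm_nonneg _) _)) (Finset.mem_univ i)
  have hΦ0 : 0 ≤ (laplaceExponent a α s).re :=
    re_laplaceExponent_nonneg ha hα (bromwichLine_re_pos y)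
  rw [norm_mul, Complex.norm_exp]
  have e1 : ((x : ℂ) * s - t * laplaceExponent a α s).re = x - t * (laplaceExponent a α s).re := by
    rw [Complex.sub_re, Complex.re_ofReal_mul, Complex.re_ofReal_mul, hs, bromwichLine_re, mul_one]
  have e2 : Real.exp (x - t * (laplaceExponent a α s).re)
      ≤ Real.exp X * Real.exp (-(t₀ * (κ * a i)) * ‖s‖ ^ α i) := by
    rw [← Real.exp_add]
    refine Real.exp_le_exp.2 ?_
    have := mul_le_mul_of_nonneg_left hΦ ht₀.le
    have := mul_le_mul_of_nonneg_right ht hΦ0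
    linarith
  have e3 : ‖G s‖ ≤ |C| * ‖s‖ ^ N := (hC y).trans (by gcongr; exact le_abs_self _)
  have e4 : (1 + y ^ 2)⁻¹ = (‖s‖ ^ 2)⁻¹ := by rw [hs, norm_bromwichLine_sq]
  rw [e1, e4, ← div_eq_mul_inv, le_div_iff₀ (by positivity)]
  calc _ ≤ (Real.exp X * Real.exp (-(t₀ * (κ * a i)) * ‖s‖ ^ α i)) * (|C| * ‖s‖ ^ N) * ‖s‖ ^ 2 := by
        gcongr
    _ = Real.exp X * (|C| * (‖s‖ ^ (N + 2) * Real.exp (-(t₀ * (κ * a i)) * ‖s‖ ^ α i))) := by ring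
    _ ≤ _ := by
        gcongr
        exact hK _ hs1

lemma continuous_bromwich_integrand {G : ℂ → ℂ} (hG : IsTame G) (x t : ℝ) :
    Continuous fun y : ℝ => Complex.exp (x * bromwichLine y
      - t * laplaceExponent a α (bromwichLine y)) * G (bromwichLine y) := by
  have h1 := hG.continuous
  have h2 := (isTame_laplaceExponent a α).continuous
  exact ((continuous_const.mul continuous_bromwichLine).sub (continuous_const.mul h2)).cexp.mul h1

lemma integrable_bromwich_integrand (hm : 1 ≤ m) (ha : ∀ j, 0 < a j)
    (hα : ∀ j, α j ∈ Ioo (0 : ℝ) 1) {G : ℂ → ℂ} (hG : IsTame G) (x : ℝ) {t : ℝ} (ht : 0 < t) :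
    Integrable fun y : ℝ => Complex.exp (x * bromwichLine y
      - t * laplaceExponent a α (bromwichLine y)) * G (bromwichLine y) := by
  obtain ⟨K, hK⟩ := exists_norm_bromwich_integrand_le hm ha hα hG x ht
  exact (integrable_inv_one_add_sq.const_mul K).mono'
    (continuous_bromwich_integrand hG x t).aestronglyMeasurable
    (.of_forall fun y => hK x le_rfl t le_rfl y)

lemma continuousAt_bromwich (hm : 1 ≤ m) (ha : ∀ j, 0 < a j)
    (hα : ∀ j, α j ∈ Ioo (0 : ℝ) 1) {G : ℂ → ℂ} (hG : IsTame G) (x : ℝ) {t : ℝ} (ht : 0 < t) :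
    ContinuousAt (fun p : ℝ × ℝ => bromwich a α G p.1 p.2) (x, t) := by
  obtain ⟨K, hK⟩ := exists_norm_bromwich_integrand_le hm ha hα hG (x + 1) (half_pos ht)
  refine continuousAt_const.mul (continuousAt_of_dominated
    (bound := fun y => K * (1 + y ^ 2)⁻¹) ?_ ?_ (integrable_inv_one_add_sq.const_mul K) ?_)
  · exact .of_forall fun p => (continuous_bromwich_integrand hG p.1 p.2).aestronglyMeasurable
  · have : Iio (x + 1) ×ˢ Ioi (t / 2) ∈ 𝓝 (x, t) :=
      prod_mem_nhds (Iio_mem_nhds (by linarith)) (Ioi_mem_nhds (by linarith))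
    filter_upwards [this] with p hp
    exact .of_forall fun y => hK _ (le_of_lt hp.1) _ (le_of_lt hp.2) y
  · exact .of_forall fun y => by fun_prop

lemma hasDerivAt_bromwich_fst (hm : 1 ≤ m) (ha : ∀ j, 0 < a j)
    (hα : ∀ j, α j ∈ Ioo (0 : ℝ) 1) {G : ℂ → ℂ} (hG : IsTame G) (x : ℝ) {t : ℝ} (ht : 0 < t) :
    HasDerivAt (fun x => bromwich a α G x t) (bromwich a α (fun s => s * G s) x t) x := by
  obtain ⟨K, hK⟩ := exists_norm_bromwich_integrand_le hm ha hα (isTame_id.mul hG) (x + 1) ht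
  refine HasDerivAt.const_mul _ (hasDerivAt_integral_of_dominated_loc_of_deriv_le
    (F := fun (x : ℝ) (y : ℝ) => Complex.exp (x * bromwichLine y
      - t * laplaceExponent a α (bromwichLine y)) * G (bromwichLine y))
    (F' := fun (x : ℝ) (y : ℝ) => Complex.exp (x * bromwichLine y
      - t * laplaceExponent a α (bromwichLine y)) * (bromwichLine y * G (bromwichLine y)))
    (bound := fun y => K * (1 + y ^ 2)⁻¹) (s := Iio (x + 1)) (Iio_mem_nhds (by linarith)) ?_
    (integrable_bromwich_integrand hm ha hα hG x ht) ?_ ?_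
    (integrable_inv_one_add_sq.const_mul K) ?_).2
  · exact .of_forall fun p => (continuous_bromwich_integrand hG p t).aestronglyMeasurable
  · exact (continuous_bromwich_integrand (isTame_id.mul hG) x t).aestronglyMeasurable
  · exact .of_forall fun y z hz => hK z (le_of_lt hz) t le_rfl y
  · refine .of_forall fun y z hz => ?_
    have h1 : HasDerivAt (fun x : ℝ => (x : ℂ) * bromwichLine y
        - t * laplaceExponent a α (bromwichLine y)) (bromwichLine y) z := by
      simpa using ((Complex.ofRealCLM.hasDerivAt (x := z)).mul_const (bromwichLine y)).sub_const
        (t * laplaceExponent a α (bromwichLine y))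
    refine (h1.cexp.mul_const (G (bromwichLine y))).congr_deriv ?_
    ring

lemma hasDerivAt_bromwich_snd (hm : 1 ≤ m) (ha : ∀ j, 0 < a j)
    (hα : ∀ j, α j ∈ Ioo (0 : ℝ) 1) {G : ℂ → ℂ} (hG : IsTame G) (x : ℝ) {t : ℝ} (ht : 0 < t) :
    HasDerivAt (fun t => bromwich a α G x t)
      (-bromwich a α (fun s => laplaceExponent a α s * G s) x t) t := by
  have hΦ := (isTame_const (-1)).mul ((isTame_laplaceExponent a α).mul hG)
  obtain ⟨K, hK⟩ := exists_norm_bromwich_integrand_le hm ha hα hΦ x (half_pos ht)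
  have key : HasDerivAt (fun t => bromwich a α G x t)
      (bromwich a α (fun s => -1 * (laplaceExponent a α s * G s)) x t) t := by
    refine HasDerivAt.const_mul _ (hasDerivAt_integral_of_dominated_loc_of_deriv_le
    (F := fun (t : ℝ) (y : ℝ) => Complex.exp (x * bromwichLine y
      - t * laplaceExponent a α (bromwichLine y)) * G (bromwichLine y))
    (F' := fun (t : ℝ) (y : ℝ) => Complex.exp (x * bromwichLine y
      - t * laplaceExponent a α (bromwichLine y)) * (-1 * (laplaceExponent a α (bromwichLine y) * G (bromwichLine y))))
      (bound := fun y => K * (1 + y ^ 2)⁻¹) (s := Ioi (t / 2)) (Ioi_mem_nhds (by linarith)) ?_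
      (integrable_bromwich_integrand hm ha hα hG x ht) ?_ ?_
      (integrable_inv_one_add_sq.const_mul K) ?_).2
    · exact .of_forall fun p => (continuous_bromwich_integrand hG x p).aestronglyMeasurable
    · exact (continuous_bromwich_integrand hΦ x t).aestronglyMeasurable
    · exact .of_forall fun y z hz => hK x le_rfl z (le_of_lt hz) y
    · refine .of_forall fun y z hz => ?_
      have h1 : HasDerivAt (fun t : ℝ => (x : ℂ) * bromwichLine y
          - t * laplaceExponent a α (bromwichLine y)) (-laplaceExponent a α (bromwichLine y)) z := by
        simpa using ((Complex.ofRealCLM.hasDerivAt (x := z)).mul_const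
          (laplaceExponent a α (bromwichLine y))).const_sub ((x : ℂ) * bromwichLine y)
      refine (h1.cexp.mul_const (G (bromwichLine y))).congr_deriv ?_
      ring
  convert key using 1
  simp only [bromwich, neg_one_mul, mul_neg, integral_neg]

lemma bromwich_congr {F G : ℂ → ℂ} (h : ∀ s, 0 < s.re → F s = G s) (x t : ℝ) :
    bromwich a α F x t = bromwich a α G x t := by
  simp only [bromwich, h _ (bromwichLine_re_pos _)]

lemma bromwich_sum (hm : 1 ≤ m) (ha : ∀ j, 0 < a j) (hα : ∀ j, α j ∈ Ioo (0 : ℝ) 1)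
    {G : Fin m → ℂ → ℂ} (hG : ∀ j, IsTame (G j)) (c : Fin m → ℝ) (x : ℝ) {t : ℝ} (ht : 0 < t) :
    bromwich a α (fun s => ∑ j, (c j : ℂ) * G j s) x t = ∑ j, (c j : ℂ) * bromwich a α (G j) x t := by
  simp only [bromwich, Finset.mul_sum]
  rw [integral_finsetSum, Finset.mul_sum]
  · refine Finset.sum_congr rfl fun j _ => ?_
    rw [mul_left_comm, ← integral_const_mul (c j : ℂ)]
    congr 1
    refine integral_congr_ae (.of_forall fun y => ?_)
    ring_nf
  · intro j _
    exact integrable_bromwich_integrand hm ha hα ((isTame_const (c j)).mul (hG j)) x ht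

/-- Convolution with `u ^ (b - 1)` multiplies the Laplace transform by `Γ(b) s ^ (-b)`. -/
lemma integral_rpow_mul_bromwich (hm : 1 ≤ m) (ha : ∀ j, 0 < a j)
    (hα : ∀ j, α j ∈ Ioo (0 : ℝ) 1) {G : ℂ → ℂ} (hG : IsTame G) (x : ℝ) {t : ℝ} (ht : 0 < t)
    {b : ℝ} (hb : 0 < b) :
    IntegrableOn (fun u : ℝ => ((u ^ (b - 1) : ℝ) : ℂ) * bromwich a α G (x - u) t) (Ioi 0) ∧
    ∫ u in Ioi (0 : ℝ), ((u ^ (b - 1) : ℝ) : ℂ) * bromwich a α G (x - u) t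
      = Real.Gamma b * bromwich a α (fun s => s ^ (-b : ℂ) * G s) x t := by
  set f : ℝ → ℂ := fun y => Complex.exp (x * bromwichLine y
      - t * laplaceExponent a α (bromwichLine y)) * G (bromwichLine y) with hf
  have hfi : Integrable f := integrable_bromwich_integrand hm ha hα hG x ht
  have hfc : Continuous f := continuous_bromwich_integrand hG x t
  have hk : IntegrableOn (fun u : ℝ => u ^ (b - 1) * Real.exp (-u)) (Ioi 0) := by
    have := integrableOn_rpow_mul_exp_neg_mul_rpow (s := b - 1) (p := 1) (b := 1) (by linarith)
      one_pos one_pos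
    simpa using this
  -- Fubini applies because `Re s = 1` gives `|exp(-su)| = exp(-u)`: the modulus splits into a Gamma
  -- integrand in `u` times an integrable function of `y`.
  have hprod : Integrable (Function.uncurry fun u y : ℝ =>
      (((u ^ (b - 1) : ℝ) : ℂ) * Complex.exp (-(bromwichLine y) * u)) * f y)
      ((volume.restrict (Ioi 0)).prod volume) := by
    refine (hk.mul_prod hfi.norm).mono' ?_ ?_
    · refine Measurable.aestronglyMeasurable ?_
      have := hfc.measurable
      have := continuous_bromwichLine.measurable
      fun_prop
    · have : ∀ᵐ p ∂((volume.restrict (Ioi (0 : ℝ))).prod (volume : Measure ℝ)), 0 < p.1 := by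
        have h0 : ∀ᵐ u ∂(volume.restrict (Ioi (0 : ℝ))), 0 < u := ae_restrict_mem measurableSet_Ioi
        exact Measure.quasiMeasurePreserving_fst.ae h0
      filter_upwards [this] with p hp
      simp only [Function.uncurry, norm_mul, Complex.norm_exp, Complex.norm_real]
      rw [Real.norm_of_nonneg (Real.rpow_nonneg hp.le _)]
      simp
  have hB : ∀ u : ℝ, ((u ^ (b - 1) : ℝ) : ℂ) * bromwich a α G (x - u) t
      = (2 * Real.pi)⁻¹ * ∫ y, (((u ^ (b - 1) : ℝ) : ℂ) * Complex.exp (-(bromwichLine y) * u)) * f y := by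
    intro u
    rw [bromwich, mul_left_comm, ← integral_const_mul]
    congr 1
    refine integral_congr_ae (.of_forall fun y => ?_)
    dsimp only
    rw [hf, mul_assoc, ← mul_assoc (Complex.exp _) (Complex.exp _), ← Complex.exp_add]
    congr 3
    push_cast
    ring
  constructor
  · refine (hprod.integral_prod_left.const_mul (((2 * Real.pi)⁻¹ : ℝ) : ℂ)).congr (.of_forall fun u => ?_)
    exact (hB u).symm
  · simp_rw [hB]
    rw [integral_const_mul, integral_integral_swap hprod, bromwich, mul_left_comm,
      ← integral_const_mul (Real.Gamma b : ℂ)]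
    congr 1
    refine integral_congr_ae (.of_forall fun y => ?_)
    dsimp only
    rw [integral_mul_const, integral_rpow_mul_cexp_neg_mul hb (bromwichLine_re_pos y), hf]
    ring

end

/-! ### Riemann-Liouville calculus on the real parts -/

section

variable {m : ℕ} {a α : Fin m → ℝ}

lemma integral_rpow_mul_re_bromwich (hm : 1 ≤ m) (ha : ∀ j, 0 < a j)
    (hα : ∀ j, α j ∈ Ioo (0 : ℝ) 1) {G : ℂ → ℂ} (hG : IsTame G) (x : ℝ) {t : ℝ} (ht : 0 < t)
    {b : ℝ} (hb : 0 < b) :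
    IntegrableOn (fun u : ℝ => u ^ (b - 1) * (bromwich a α G (x - u) t).re) (Ioi 0) ∧
    ∫ u in Ioi (0 : ℝ), u ^ (b - 1) * (bromwich a α G (x - u) t).re
      = Real.Gamma b * (bromwich a α (fun s => s ^ (-b : ℂ) * G s) x t).re := by
  obtain ⟨h1, h2⟩ := integral_rpow_mul_bromwich hm ha hα hG x ht hb
  have h3 : IntegrableOn (fun u : ℝ =>
      (((u ^ (b - 1) : ℝ) : ℂ) * bromwich a α G (x - u) t).re) (Ioi 0) := h1.re
  have h4 : ∫ u in Ioi (0 : ℝ), (((u ^ (b - 1) : ℝ) : ℂ) * bromwich a α G (x - u) t).re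
      = (∫ u in Ioi (0 : ℝ), ((u ^ (b - 1) : ℝ) : ℂ) * bromwich a α G (x - u) t).re :=
    integral_re h1
  rw [h2] at h4
  simp only [Complex.re_ofReal_mul] at h3 h4
  exact ⟨h3, h4⟩

/-- The kernel lives on `u > 0`, so the convolution at `x ≤ 0` sees only arguments `x - u < 0`. -/
lemma re_bromwich_rpow_mul_eq_zero (hm : 1 ≤ m) (ha : ∀ j, 0 < a j)
    (hα : ∀ j, α j ∈ Ioo (0 : ℝ) 1) {G : ℂ → ℂ} (hG : IsTame G) {t : ℝ} (ht : 0 < t)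
    (h0 : ∀ x ≤ 0, (bromwich a α G x t).re = 0) {b : ℝ} (hb : 0 < b) :
    ∀ x ≤ 0, (bromwich a α (fun s => s ^ (-b : ℂ) * G s) x t).re = 0 := by
  intro x hx
  have h := (integral_rpow_mul_re_bromwich hm ha hα hG x ht hb).2
  rw [setIntegral_eq_zero_of_forall_eq_zero] at h
  · exact (mul_eq_zero.1 h.symm).resolve_left (Real.Gamma_pos_of_pos hb).ne'
  · intro u hu
    rw [h0 _ (by linarith [mem_Ioi.1 hu]), mul_zero]

lemma re_bromwich_rpow_mul_nonneg (hm : 1 ≤ m) (ha : ∀ j, 0 < a j)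
    (hα : ∀ j, α j ∈ Ioo (0 : ℝ) 1) {G : ℂ → ℂ} (hG : IsTame G) {t : ℝ} (ht : 0 < t)
    (h0 : ∀ x, 0 ≤ (bromwich a α G x t).re) {b : ℝ} (hb : 0 < b) (x : ℝ) :
    0 ≤ (bromwich a α (fun s => s ^ (-b : ℂ) * G s) x t).re := by
  have h := (integral_rpow_mul_re_bromwich hm ha hα hG x ht hb).2
  have h1 : 0 ≤ ∫ u in Ioi (0 : ℝ), u ^ (b - 1) * (bromwich a α G (x - u) t).re :=
    setIntegral_nonneg measurableSet_Ioi fun u hu =>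
      mul_nonneg (Real.rpow_nonneg (le_of_lt hu) _) (h0 _)
  rw [h] at h1
  exact nonneg_of_mul_nonneg_right h1 (Real.Gamma_pos_of_pos hb)

/-- Riemann-Liouville integrals of functions supported on the positive half-line. -/
lemma integral_Ioo_re_bromwich_mul_rpow (hm : 1 ≤ m) (ha : ∀ j, 0 < a j)
    (hα : ∀ j, α j ∈ Ioo (0 : ℝ) 1) {G : ℂ → ℂ} (hG : IsTame G) {t : ℝ} (ht : 0 < t)
    (h0 : ∀ x ≤ 0, (bromwich a α G x t).re = 0) {b : ℝ} (hb : 0 < b) (x : ℝ) :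
    IntegrableOn (fun s : ℝ => (bromwich a α G s t).re * (x - s) ^ (b - 1)) (Ioo 0 x) ∧
    ∫ s in Ioo 0 x, (bromwich a α G s t).re * (x - s) ^ (b - 1)
      = Real.Gamma b * (bromwich a α (fun s => s ^ (-b : ℂ) * G s) x t).re := by
  obtain ⟨h1, h2⟩ := integral_rpow_mul_re_bromwich hm ha hα hG x ht hb
  -- Substitution `u = x - s`; vanishing for `s ≤ 0` cuts the half-line down to `(0, x)`.
  have hF : ∀ s, (Ioi (0 : ℝ)).indicator
        (fun u : ℝ => u ^ (b - 1) * (bromwich a α G (x - u) t).re) (x - s)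
      = (Ioo 0 x).indicator (fun s : ℝ => (bromwich a α G s t).re * (x - s) ^ (b - 1)) s := by
    intro s
    by_cases hs : s < x
    · rw [indicator_of_mem (by simpa using hs), sub_sub_cancel, mul_comm]
      by_cases hs0 : 0 < s
      · rw [indicator_of_mem (mem_Ioo.2 ⟨hs0, hs⟩)]
      · rw [indicator_of_notMem (fun h => hs0 h.1), h0 s (not_lt.1 hs0), zero_mul]
    · rw [indicator_of_notMem (by simpa using hs), indicator_of_notMem (fun h => hs h.2)]
  constructor
  · rw [← integrable_indicator_iff measurableSet_Ioo]
    rw [← integrable_indicator_iff measurableSet_Ioi] at h1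
    exact (h1.comp_sub_left x).congr (.of_forall hF)
  · rw [← h2, ← integral_indicator measurableSet_Ioo, ← integral_indicator measurableSet_Ioi,
      ← integral_sub_left_eq_self (indicator (Ioi 0) _) volume x]
    exact integral_congr_ae (.of_forall fun s => (hF s).symm)

lemma hasDerivAt_re_bromwich_fst (hm : 1 ≤ m) (ha : ∀ j, 0 < a j)
    (hα : ∀ j, α j ∈ Ioo (0 : ℝ) 1) {G : ℂ → ℂ} (hG : IsTame G) (x : ℝ) {t : ℝ} (ht : 0 < t) :
    HasDerivAt (fun x => (bromwich a α G x t).re) (bromwich a α (fun s => s * G s) x t).re x :=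
  Complex.reCLM.hasFDerivAt.comp_hasDerivAt x (hasDerivAt_bromwich_fst hm ha hα hG x ht)

lemma hasDerivAt_re_bromwich_snd (hm : 1 ≤ m) (ha : ∀ j, 0 < a j)
    (hα : ∀ j, α j ∈ Ioo (0 : ℝ) 1) {G : ℂ → ℂ} (hG : IsTame G) (x : ℝ) {t : ℝ} (ht : 0 < t) :
    HasDerivAt (fun t => (bromwich a α G x t).re)
      (-(bromwich a α (fun s => laplaceExponent a α s * G s) x t).re) t :=
  (Complex.reCLM.hasFDerivAt.comp_hasDerivAt t (hasDerivAt_bromwich_snd hm ha hα hG x ht))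

/-- The Riemann-Liouville derivative of order `γ` multiplies the Laplace transform by `s ^ γ`. -/
lemma hasRLDerivAt_re_bromwich (hm : 1 ≤ m) (ha : ∀ j, 0 < a j)
    (hα : ∀ j, α j ∈ Ioo (0 : ℝ) 1) {G : ℂ → ℂ} (hG : IsTame G) {t : ℝ} (ht : 0 < t)
    (h0 : ∀ x ≤ 0, (bromwich a α G x t).re = 0) {γ : ℝ} (hγ : γ < 1) {x : ℝ} :
    HasRLDerivAt γ (fun x => (bromwich a α G x t).re)
      (bromwich a α (fun s => s ^ (γ : ℂ) * G s) x t).re x := by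
  -- The kernel `(y - s)^(-γ)` is the power kernel with `b = 1 - γ`: integration yields `Γ(1 - γ)
  -- s^(γ - 1)`, the derivative adds a factor `s`, and the prefactor cancels the Gamma value.
  have hb : 0 < 1 - γ := by linarith
  have key := integral_Ioo_re_bromwich_mul_rpow hm ha hα hG ht h0 hb
  have e : ∀ y, ∀ s ∈ Ioo 0 y, (bromwich a α G s t).re * (y - s) ^ ((1 - γ) - 1)
      = (bromwich a α G s t).re / (y - s) ^ γ := by
    intro y s hs
    rw [show 1 - γ - 1 = -γ by ring, Real.rpow_neg (by linarith [hs.2]), div_eq_mul_inv]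
  constructor
  · exact .of_forall fun y => (key y).1.congr_fun (e y) measurableSet_Ioo
  · have hG' : IsTame fun s => s ^ (-(1 - γ : ℝ) : ℂ) * G s := by
      simpa using (isTame_cpow (-(1 - γ))).mul hG
    have hd := hasDerivAt_re_bromwich_fst hm ha hα hG' x ht
    rw [bromwich_congr (G := fun s => s ^ (γ : ℂ) * G s)] at hd
    · refine hd.congr_of_eventuallyEq (.of_forall fun y => ?_)
      dsimp only
      rw [← setIntegral_congr_fun measurableSet_Ioo (e y), (key y).2, one_div,
        inv_mul_cancel_left₀ (Real.Gamma_pos_of_pos hb).ne']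
    · intro s hs
      have hs0 : s ≠ 0 := by rintro rfl; simp at hs
      rw [← mul_assoc]
      nth_rewrite 1 [← Complex.cpow_one s]
      rw [← Complex.cpow_add _ _ hs0]
      push_cast
      ring_nf

/-- Integration by parts along the Bromwich line. -/
lemma mul_bromwich_eq_neg_bromwich_deriv (hm : 1 ≤ m) (ha : ∀ j, 0 < a j)
    (hα : ∀ j, α j ∈ Ioo (0 : ℝ) 1) {G G' Φ' : ℂ → ℂ} (hG : IsTame G) (hG' : IsTame G')
    (hΦ' : IsTame Φ') (hd : ∀ s : ℂ, 0 < s.re → HasDerivAt G (G' s) s)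
    (hdΦ : ∀ s : ℂ, 0 < s.re → HasDerivAt (laplaceExponent a α) (Φ' s) s) (x : ℝ) {t : ℝ}
    (ht : 0 < t) :
    x * bromwich a α G x t = -bromwich a α (fun s => G' s - t * Φ' s * G s) x t := by
  have hW : IsTame fun s => G' s + (-t * Φ' s) * G s :=
    hG'.add (((isTame_const (-t)).mul hΦ').mul hG)
  have hu : ∀ y : ℝ, HasDerivAt (fun y : ℝ => Complex.exp (x * bromwichLine y))
      (Complex.exp (x * bromwichLine y) * (x * Complex.I)) y := fun y =>
    ((hasDerivAt_bromwichLine y).const_mul (x : ℂ)).cexp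
  have hv : ∀ y : ℝ, HasDerivAt (fun y : ℝ => Complex.exp (-(t * laplaceExponent a α (bromwichLine y)))
        * G (bromwichLine y))
      (Complex.exp (-(t * laplaceExponent a α (bromwichLine y))) *
        ((G' (bromwichLine y) + (-t * Φ' (bromwichLine y)) * G (bromwichLine y)) * Complex.I)) y := by
    intro y
    have h1 : HasDerivAt (fun y => laplaceExponent a α (bromwichLine y))
        (Φ' (bromwichLine y) * Complex.I) y :=
      (hdΦ _ (bromwichLine_re_pos y)).comp y (hasDerivAt_bromwichLine y)
    have h2 : HasDerivAt (fun y => G (bromwichLine y)) (G' (bromwichLine y) * Complex.I) y :=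
      (hd _ (bromwichLine_re_pos y)).comp y (hasDerivAt_bromwichLine y)
    refine ((h1.const_mul (t : ℂ)).neg.cexp.mul h2).congr_deriv ?_
    simp only [Pi.neg_apply]
    ring
  have hexp : ∀ y : ℝ, Complex.exp (x * bromwichLine y - t * laplaceExponent a α (bromwichLine y))
      = Complex.exp (x * bromwichLine y) * Complex.exp (-(t * laplaceExponent a α (bromwichLine y))) := by
    intro y
    rw [← Complex.exp_add, sub_eq_add_neg]
  -- Integrability of the product itself, the last of the three conditions, takes care of the
  -- boundary terms at infinity.
  have key := integral_mul_deriv_eq_deriv_mul_of_integrable (fun y _ => hu y) (fun y _ => hv y)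
    (((integrable_bromwich_integrand hm ha hα hW x ht).mul_const Complex.I).congr
      (.of_forall fun y => by simp only [hexp, Pi.mul_apply]; ring))
    (((integrable_bromwich_integrand hm ha hα hG x ht).const_mul (x * Complex.I)).congr
      (.of_forall fun y => by simp only [hexp, Pi.mul_apply]; ring))
    ((integrable_bromwich_integrand hm ha hα hG x ht).congr
      (.of_forall fun y => by simp only [hexp, Pi.mul_apply]; ring))
  have e1 : ∫ y : ℝ, Complex.exp (x * bromwichLine y) *
      (Complex.exp (-(t * laplaceExponent a α (bromwichLine y))) *
        ((G' (bromwichLine y) + (-t * Φ' (bromwichLine y)) * G (bromwichLine y)) * Complex.I))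
      = Complex.I * ∫ y : ℝ, Complex.exp (x * bromwichLine y
          - t * laplaceExponent a α (bromwichLine y)) *
          (G' (bromwichLine y) - t * Φ' (bromwichLine y) * G (bromwichLine y)) := by
    rw [← integral_const_mul]
    refine integral_congr_ae (.of_forall fun y => ?_)
    simp only [hexp]
    ring
  have e2 : ∫ y : ℝ, Complex.exp (x * bromwichLine y) * (x * Complex.I) *
      (Complex.exp (-(t * laplaceExponent a α (bromwichLine y))) * G (bromwichLine y))
      = (x * Complex.I) * ∫ y : ℝ, Complex.exp (x * bromwichLine y
          - t * laplaceExponent a α (bromwichLine y)) * G (bromwichLine y) := by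
    rw [← integral_const_mul]
    refine integral_congr_ae (.of_forall fun y => ?_)
    simp only [hexp]
    ring
  rw [e1, e2] at key
  have gen : ∀ A B c : ℂ, Complex.I * A = -(x * Complex.I * B) → x * (c * B) = -(c * A) := by
    intro A B c h
    have : A = -(x * B) := mul_left_cancel₀ Complex.I_ne_zero (by rw [h]; ring)
    rw [this]
    ring
  exact gen _ _ _ key

end

/-! ### Inversion of powers and the boundary value of the inverse density -/

lemma integrable_norm_bromwichLine_rpow {p : ℝ} (hp : 1 < p) :
    Integrable fun y => ‖bromwichLine y‖ ^ (-p) := by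
  have := integrable_rpow_neg_one_add_norm_sq (E := ℝ) (μ := volume) (r := p) (by simpa using hp)
  refine this.congr (.of_forall fun y => ?_)
  dsimp only
  rw [Real.norm_eq_abs, sq_abs, ← norm_bromwichLine_sq, ← Real.rpow_natCast,
    ← Real.rpow_mul (norm_nonneg _)]
  congr 1
  push_cast
  ring

/-- The inverse Laplace transform of `s ^ (-p)`. -/
lemma integral_cexp_mul_bromwichLine_cpow {p : ℝ} (hp : 1 < p) {t : ℝ} (ht : 0 < t) :
    (2 * Real.pi)⁻¹ * ∫ y : ℝ, Complex.exp (t * bromwichLine y) * bromwichLine y ^ (-p : ℂ)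
      = ((t ^ (p - 1) / Real.Gamma p : ℝ) : ℂ) := by
  have hp0 : 0 < p := by linarith
  have hpi : (2 * Real.pi) ≠ 0 := by positivity
  -- The damping `exp(-u)` moves the Fourier transform of `u^(p-1)` onto the line `Re s = 1`, where
  -- it is `Γ(p) s^(-p)`. This is integrable because `p > 1`, so Fourier inversion holds at the
  -- continuity point `t > 0`.
  set f : ℝ → ℂ := (Ioi (0 : ℝ)).indicator
    fun u => ((u ^ (p - 1) : ℝ) : ℂ) * Complex.exp (-u) with hf
  have hfi : Integrable f := by
    rw [hf, integrable_indicator_iff measurableSet_Ioi]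
    have := (integrableOn_rpow_mul_exp_neg_mul_rpow (s := p - 1) (p := 1) (b := 1) (by linarith)
      one_pos one_pos).ofReal (𝕜 := ℂ)
    simpa [IntegrableOn] using this
  have hF : ∀ ξ : ℝ, FourierTransform.fourier f ξ
      = Real.Gamma p * bromwichLine (2 * Real.pi * ξ) ^ (-p : ℂ) := by
    intro ξ
    rw [Real.fourier_real_eq_integral_exp_smul,
      ← integral_rpow_mul_cexp_neg_mul hp0 (bromwichLine_re_pos _),
      ← integral_indicator measurableSet_Ioi]
    refine integral_congr_ae (.of_forall fun u => ?_)
    by_cases hu : u ∈ Ioi (0 : ℝ)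
    · simp only [hf, indicator_of_mem hu, smul_eq_mul]
      rw [mul_left_comm, ← Complex.exp_add]
      congr 2
      rw [bromwichLine]
      push_cast
      ring
    · simp only [hf, indicator_of_notMem hu, smul_zero]
  have hint : Integrable fun y : ℝ => bromwichLine y ^ (-p : ℂ) := by
    refine (integrable_norm_bromwichLine_rpow hp).mono' ?_ (.of_forall fun y => ?_)
    · have := (isTame_cpow (-p)).continuous.aestronglyMeasurable (μ := volume)
      simpa using this
    · rw [← Complex.ofReal_neg, Complex.norm_cpow_real]
  have hFi : Integrable (FourierTransform.fourier f) := by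
    refine ((hint.comp_mul_left' hpi).const_mul (Real.Gamma p : ℂ)).congr (.of_forall fun ξ => ?_)
    exact (hF ξ).symm
  have hc : ContinuousAt f t := by
    have h1 : ContinuousAt (fun u : ℝ => ((u ^ (p - 1) : ℝ) : ℂ) * Complex.exp (-u)) t := by
      have := Real.continuousAt_rpow_const t (p - 1) (Or.inl ht.ne')
      fun_prop
    refine h1.congr ?_
    filter_upwards [Ioi_mem_nhds ht] with u hu
    rw [hf, indicator_of_mem hu]
  have inv := hfi.fourierInv_fourier_eq hFi hc
  rw [Real.fourierInv_eq'] at inv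
  simp_rw [hF] at inv
  have hsub := Measure.integral_comp_mul_left
    (fun y : ℝ => Complex.exp (t * bromwichLine y) * bromwichLine y ^ (-p : ℂ)) (2 * Real.pi)
  rw [abs_of_pos (by positivity), Complex.real_smul] at hsub
  rw [← hsub]
  have hΓ : (Real.Gamma p : ℂ) ≠ 0 := by exact_mod_cast (Real.Gamma_pos_of_pos hp0).ne'
  have hft : f t = ((t ^ (p - 1) : ℝ) : ℂ) * Complex.exp (-t) := by
    rw [hf, indicator_of_mem (mem_Ioi.2 ht)]
  have e : ∫ ξ : ℝ, Complex.exp (t * bromwichLine (2 * Real.pi * ξ))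
        * bromwichLine (2 * Real.pi * ξ) ^ (-p : ℂ)
      = Complex.exp t * (Real.Gamma p : ℂ)⁻¹ * f t := by
    rw [← inv, ← integral_const_mul]
    refine integral_congr_ae (.of_forall fun ξ => ?_)
    dsimp only
    rw [smul_eq_mul, show (t : ℂ) * bromwichLine (2 * Real.pi * ξ)
      = t + ((2 * Real.pi * inner ℝ ξ t : ℝ) : ℂ) * Complex.I by
        simp [bromwichLine]; ring, Complex.exp_add]
    field_simp
  rw [e, hft, Complex.ofReal_div]
  have : Complex.exp t * Complex.exp (-t) = 1 := by rw [← Complex.exp_add]; simp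
  rw [div_eq_mul_inv]
  linear_combination ((t ^ (p - 1) : ℝ) : ℂ) * (Real.Gamma p : ℂ)⁻¹ * this

section

variable {m : ℕ} {a α : Fin m → ℝ}

lemma hasDerivAt_sum_mul_cpow (c β : Fin m → ℝ) {s : ℂ} (hs : 0 < s.re) :
    HasDerivAt (fun s : ℂ => ∑ j, (c j : ℂ) * s ^ (β j : ℂ))
      (∑ j, ((c j * β j : ℝ) : ℂ) * s ^ ((β j - 1 : ℝ) : ℂ)) s := by
  refine (HasDerivAt.fun_sum fun j _ =>
    ((hasDerivAt_id s).cpow_const (c := (β j : ℂ)) (Or.inl hs)).const_mul (c j : ℂ)).congr_deriv ?_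
  refine Finset.sum_congr rfl fun j _ => ?_
  simp only [id]
  push_cast
  ring

lemma isTame_sum_mul_cpow (c β : Fin m → ℝ) :
    IsTame fun s : ℂ => ∑ j, (c j : ℂ) * s ^ (β j : ℂ) :=
  isTame_laplaceExponent c β

lemma norm_sum_mul_cpow_le (c β : Fin m → ℝ) (s : ℂ) :
    ‖∑ j, (c j : ℂ) * s ^ (β j : ℂ)‖ ≤ ∑ j, |c j| * ‖s‖ ^ β j := by
  refine (norm_sum_le _ _).trans (Finset.sum_le_sum fun j _ => ?_)
  rw [norm_mul, Complex.norm_cpow_real, Complex.norm_real, Real.norm_eq_abs]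

lemma mul_sum_mul_cpow_sub_one (c β : Fin m → ℝ) {s : ℂ} (hs : s ≠ 0) :
    s * ∑ j, (c j : ℂ) * s ^ ((β j - 1 : ℝ) : ℂ) = ∑ j, (c j : ℂ) * s ^ (β j : ℂ) := by
  rw [Finset.mul_sum]
  refine Finset.sum_congr rfl fun j _ => ?_
  push_cast
  rw [Complex.cpow_sub _ _ hs, Complex.cpow_one]
  field_simp

/-- At `x = 0` the integrand is of size `|s|^(α-1)`, not absolutely integrable. Multiplying by `t`
and integrating by parts replaces `R = Φ/s` by `R' - xΦ'R`. Here `R'` is of integrable size `S = ∑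
a_j |s|^(α_j - 2)`. The other term is controlled uniformly in `x`, since `|Φ'| ≤ S|s|`, `|s||R| =
|Φ|` and `x|Φ| exp(-x Re Φ) ≤ 1/κ`. Dominated convergence leaves the inverse transform of `R'`. The
first argument of `bromwich` is here the time `t`, the second is `x`. -/
lemma tendsto_re_bromwich_nhdsGT_zero (hm : 1 ≤ m) (ha : ∀ j, 0 < a j)
    (hα : ∀ j, α j ∈ Ioo (0 : ℝ) 1) {t : ℝ} (ht : 0 < t) :
    Tendsto (fun x => (bromwich a α (fun s => ∑ j, (a j : ℂ) * s ^ ((α j - 1 : ℝ) : ℂ)) t x).re)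
      (𝓝[>] 0) (𝓝 (∑ j, a j * (t ^ (-(α j)) / Real.Gamma (1 - α j)))) := by
  obtain ⟨κ, hκ, hre⟩ := exists_le_re_laplaceExponent ha hα
  set R : ℂ → ℂ := fun s => ∑ j, (a j : ℂ) * s ^ ((α j - 1 : ℝ) : ℂ) with hR
  set R' : ℂ → ℂ := fun s => ∑ j, ((a j * (α j - 1) : ℝ) : ℂ) * s ^ ((α j - 1 - 1 : ℝ) : ℂ) with hR'
  set Φ' : ℂ → ℂ := fun s => ∑ j, ((a j * α j : ℝ) : ℂ) * s ^ ((α j - 1 : ℝ) : ℂ) with hΦ'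
  have tR : IsTame R := isTame_sum_mul_cpow _ _
  have tR' : IsTame R' := isTame_sum_mul_cpow _ _
  have tΦ' : IsTame Φ' := isTame_sum_mul_cpow _ _
  set S : ℂ → ℝ := fun s => ∑ j, a j * ‖s‖ ^ (α j - 2) with hS
  have hS0 : ∀ s, 0 ≤ S s := fun s =>
    Finset.sum_nonneg fun j _ => mul_nonneg (ha j).le (Real.rpow_nonneg (norm_nonneg _) _)
  have bR' : ∀ s, ‖R' s‖ ≤ S s := by
    intro s
    refine (norm_sum_mul_cpow_le _ _ s).trans (Finset.sum_le_sum fun j _ => ?_)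
    rw [show α j - 1 - 1 = α j - 2 by ring]
    refine mul_le_mul_of_nonneg_right ?_ (Real.rpow_nonneg (norm_nonneg _) _)
    rw [abs_le]
    constructor <;> nlinarith [ha j, (hα j).1, (hα j).2]
  have bΦ' : ∀ y, ‖Φ' (bromwichLine y)‖ ≤ S (bromwichLine y) * ‖bromwichLine y‖ := by
    intro y
    refine (norm_sum_mul_cpow_le _ _ _).trans ?_
    rw [hS, Finset.sum_mul]
    refine Finset.sum_le_sum fun j _ => ?_
    have hpos : 0 < ‖bromwichLine y‖ := by linarith [one_le_norm_bromwichLine y]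
    have e : ‖bromwichLine y‖ ^ (α j - 2) * ‖bromwichLine y‖ = ‖bromwichLine y‖ ^ (α j - 1) := by
      rw [← Real.rpow_add_one hpos.ne']
      ring_nf
    rw [mul_assoc, e]
    refine mul_le_mul_of_nonneg_right ?_ (Real.rpow_nonneg (norm_nonneg _) _)
    rw [abs_le]
    constructor <;> nlinarith [ha j, (hα j).1, (hα j).2]
  have hlim : Tendsto (fun x : ℝ => bromwich a α (fun s => R' s - x * Φ' s * R s) t x) (𝓝[>] 0)
      (𝓝 (((2 * Real.pi)⁻¹ : ℝ) *
        ∫ y : ℝ, Complex.exp (t * bromwichLine y) * R' (bromwichLine y))) := by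
    refine Tendsto.const_mul _ (tendsto_integral_filter_of_dominated_convergence
      (fun y => Real.exp t * ((1 + κ⁻¹) * S (bromwichLine y))) ?_ ?_ ?_ ?_)
    · refine .of_forall fun x => (continuous_bromwich_integrand (G := fun s => R' s - x * Φ' s * R s)
        ?_ t x).aestronglyMeasurable
      simpa [sub_eq_add_neg] using tR'.add (((isTame_const (-x)).mul tΦ').mul tR)
    · filter_upwards [self_mem_nhdsWithin] with x hx
      refine .of_forall fun y => ?_
      have hx0 : 0 < x := hx
      set s := bromwichLine y with hs
      have hΦ0 : 0 ≤ (laplaceExponent a α s).re :=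
        re_laplaceExponent_nonneg ha hα (bromwichLine_re_pos y)
      have hΦ : κ * ‖laplaceExponent a α s‖ ≤ (laplaceExponent a α s).re :=
        (mul_le_mul_of_nonneg_left (norm_laplaceExponent_le ha s) hκ.le).trans
          (hre s (bromwichLine_re_pos y))
      have hsR : ‖s‖ * ‖R s‖ = ‖laplaceExponent a α s‖ := by
        rw [← norm_mul, hR]
        dsimp only
        rw [mul_sum_mul_cpow_sub_one _ _ (bromwichLine_ne_zero y)]
        rfl
      set E := Real.exp (-(x * (laplaceExponent a α s).re)) with hE
      have hE1 : E ≤ 1 := Real.exp_le_one_iff.2 (by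
        have := mul_nonneg hx0.le hΦ0
        linarith)
      -- From `v ≤ exp v` at `v = x Re Φ`, together with `κ|Φ| ≤ Re Φ`.
      have hE2 : E * (x * ‖laplaceExponent a α s‖) ≤ κ⁻¹ := by
        have h1 := Real.add_one_le_exp (x * (laplaceExponent a α s).re)
        have h2 : E * Real.exp (x * (laplaceExponent a α s).re) = 1 := by
          rw [hE, ← Real.exp_add]; simp
        have hE0 : 0 < E := Real.exp_pos _
        have h3 : κ * (x * ‖laplaceExponent a α s‖) ≤ Real.exp (x * (laplaceExponent a α s).re) := by
          nlinarith
        rw [← one_div, le_div_iff₀ hκ]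
        nlinarith
      rw [norm_mul, Complex.norm_exp]
      have e1 : ((t : ℂ) * s - x * laplaceExponent a α s).re
          = t + -(x * (laplaceExponent a α s).re) := by
        rw [Complex.sub_re, Complex.re_ofReal_mul, Complex.re_ofReal_mul, hs, bromwichLine_re,
          mul_one, sub_eq_add_neg]
      rw [e1, Real.exp_add, mul_assoc]
      refine mul_le_mul_of_nonneg_left ?_ (Real.exp_pos _).le
      calc E * ‖R' s - x * Φ' s * R s‖ ≤ E * (‖R' s‖ + x * ‖Φ' s‖ * ‖R s‖) := by
            refine mul_le_mul_of_nonneg_left ((norm_sub_le _ _).trans (le_of_eq ?_))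
              (Real.exp_pos _).le
            rw [norm_mul, norm_mul, Complex.norm_real, Real.norm_of_nonneg hx0.le]
        _ ≤ E * (S s + x * (S s * ‖s‖) * ‖R s‖) := by
            have := bΦ' y
            have := bR' s
            gcongr
        _ = E * S s + S s * (E * (x * ‖laplaceExponent a α s‖)) := by rw [← hsR]; ring
        _ ≤ 1 * S s + S s * κ⁻¹ :=
            add_le_add (mul_le_mul_of_nonneg_right hE1 (hS0 s))
              (mul_le_mul_of_nonneg_left hE2 (hS0 s))
        _ = _ := by ring
    · refine Integrable.const_mul (Integrable.const_mul ?_ _) _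
      rw [hS]
      refine integrable_finsetSum _ fun j _ => Integrable.const_mul ?_ _
      have := integrable_norm_bromwichLine_rpow (p := 2 - α j) (by linarith [(hα j).2])
      simpa using this
    · refine .of_forall fun y => ?_
      have hc : Continuous fun x : ℝ => Complex.exp (t * bromwichLine y
          - x * laplaceExponent a α (bromwichLine y)) *
          (R' (bromwichLine y) - x * Φ' (bromwichLine y) * R (bromwichLine y)) := by fun_prop
      have := (hc.tendsto 0).mono_left (nhdsWithin_le_nhds (s := Ioi 0))
      simpa using this
  have hval : (((2 * Real.pi)⁻¹ : ℝ) *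
        ∫ y : ℝ, Complex.exp (t * bromwichLine y) * R' (bromwichLine y) : ℂ)
      = -((t * ∑ j, a j * (t ^ (-(α j)) / Real.Gamma (1 - α j)) : ℝ) : ℂ) := by
    have hj : ∀ j, Integrable fun y : ℝ => Complex.exp (t * bromwichLine y)
        * (((a j * (α j - 1) : ℝ) : ℂ) * bromwichLine y ^ ((α j - 1 - 1 : ℝ) : ℂ)) := by
      intro j
      refine ((integrable_norm_bromwichLine_rpow (p := 2 - α j)
        (by linarith [(hα j).2])).const_mul (Real.exp t * |a j * (α j - 1)|)).mono' ?_ ?_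
      · have := (isTame_cpow (α j - 1 - 1)).continuous
        exact Continuous.aestronglyMeasurable (by fun_prop)
      · refine .of_forall fun y => le_of_eq ?_
        rw [norm_mul, norm_mul, Complex.norm_exp, Complex.norm_cpow_real, Complex.norm_real,
          Complex.re_ofReal_mul, bromwichLine_re, mul_one, Real.norm_eq_abs, ← mul_assoc]
        ring_nf
    simp only [hR', Finset.mul_sum]
    rw [integral_finsetSum _ fun j _ => hj j, Finset.mul_sum]
    push_cast
    rw [← Finset.sum_neg_distrib]
    refine Finset.sum_congr rfl fun j _ => ?_
    have hp : 1 < 2 - α j := by linarith [(hα j).2]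
    have h := integral_cexp_mul_bromwichLine_cpow hp ht
    have e : ∫ y : ℝ, Complex.exp (t * bromwichLine y)
        * (((a j : ℂ) * (α j - 1)) * bromwichLine y ^ ((α j : ℂ) - 1 - 1))
        = ((a j : ℂ) * (α j - 1)) * ∫ y : ℝ, Complex.exp (t * bromwichLine y)
          * bromwichLine y ^ (-((2 - α j : ℝ) : ℂ)) := by
      rw [← integral_const_mul]
      refine integral_congr_ae (.of_forall fun y => ?_)
      dsimp only
      rw [show -((2 - α j : ℝ) : ℂ) = (α j : ℂ) - 1 - 1 by push_cast; ring]
      ring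
    rw [e, mul_left_comm]
    push_cast at h ⊢
    rw [h]
    -- The recursion cancels the factor `α j - 1` produced by differentiating `R`, up to the sign of
    -- the integration by parts.
    have hΓ : Real.Gamma (2 - α j) = (1 - α j) * Real.Gamma (1 - α j) := by
      rw [← Real.Gamma_add_one (by linarith [(hα j).2])]; ring_nf
    have ht1 : t ^ (2 - α j - 1) = t * t ^ (-(α j)) := by
      rw [show 2 - α j - 1 = 1 + -(α j) by ring, Real.rpow_add ht, Real.rpow_one]
    have h1 : Real.Gamma (1 - α j) ≠ 0 := (Real.Gamma_pos_of_pos (by linarith [(hα j).2])).ne'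
    have h2 : 1 - α j ≠ 0 := by linarith [(hα j).2]
    rw [hΓ, ht1]
    norm_cast
    field_simp
    ring
  have hmain : Tendsto (fun x : ℝ => bromwich a α R t x) (𝓝[>] 0)
      (𝓝 ((∑ j, a j * (t ^ (-(α j)) / Real.Gamma (1 - α j)) : ℝ) : ℂ)) := by
    have h := (hlim.neg).const_mul ((t : ℂ)⁻¹)
    have ht' : (t : ℂ) ≠ 0 := by exact_mod_cast ht.ne'
    rw [hval, neg_neg, Complex.ofReal_mul, inv_mul_cancel_left₀ ht'] at h
    refine h.congr' ?_
    filter_upwards [self_mem_nhdsWithin] with x hx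
    rw [← mul_bromwich_eq_neg_bromwich_deriv hm ha hα tR tR' tΦ'
      (fun s hs => hasDerivAt_sum_mul_cpow _ _ hs) (fun s hs => hasDerivAt_sum_mul_cpow _ _ hs) t hx,
      inv_mul_cancel_left₀ ht']
  exact (Complex.continuous_re.tendsto _).comp hmain

end

/-! ### From the Laplace transform to the density -/

/-- Transfers the sign of the masses of small intervals to the continuous density at every point,
not merely almost everywhere. -/
lemma nonneg_of_forall_integral_Icc_nonneg {g : ℝ → ℝ} (hg : Continuous g) {x : ℝ}
    (h : ∀ᶠ δ in 𝓝[>] (0 : ℝ), 0 ≤ ∫ y in Icc (x - δ) (x + δ), g y) : 0 ≤ g x := by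
  by_contra! hx
  obtain ⟨ε, hε, hball⟩ := Metric.eventually_nhds_iff.1
    (hg.continuousAt.eventually (gt_mem_nhds (show g x < g x / 2 by linarith)))
  obtain ⟨δ, hδ, hδε⟩ := (h.and (Ioo_mem_nhdsGT hε)).exists
  have h1 : ∫ y in Icc (x - δ) (x + δ), g y ≤ ∫ _ in Icc (x - δ) (x + δ), g x / 2 := by
    refine setIntegral_mono_on (hg.integrableOn_Icc) (by simp) measurableSet_Icc fun y hy => ?_
    refine (hball ?_).le
    rw [Real.dist_eq, abs_lt]
    constructor <;> linarith [hy.1, hy.2, hδε.2]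
  rw [setIntegral_const, smul_eq_mul, Real.volume_real_Icc_of_le (by linarith [hδε.1])] at h1
  nlinarith [hδε.1]

section

variable {m : ℕ} {a α : Fin m → ℝ}

lemma analyticOnNhd_exp_neg_laplaceExponent (t : ℝ) :
    AnalyticOnNhd ℂ (fun s => Complex.exp (-t * laplaceExponent a α s)) {s | 0 < s.re} := by
  intro s hs
  refine (analyticAt_const.mul ?_).cexp
  exact Finset.analyticAt_fun_sum _ fun j _ =>
    analyticAt_const.mul (analyticAt_id.cpow analyticAt_const (Or.inl hs))

lemma laplaceExponent_ofReal {s : ℝ} (hs : 0 < s) :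
    laplaceExponent a α s = ((∑ j, a j * s ^ α j : ℝ) : ℂ) := by
  rw [laplaceExponent]
  push_cast [Complex.ofReal_cpow hs.le]
  rfl

variable {μ : Measure ℝ} [IsFiniteMeasure μ]

lemma integral_cexp_neg_mul_eq_exp_laplaceExponent (hμ0 : ∀ᵐ x ∂μ, 0 ≤ x) {t : ℝ}
    (hμ : ∀ s : ℝ, 0 < s → ∫ x, Real.exp (-s * x) ∂μ = Real.exp (-t * ∑ j, a j * s ^ α j))
    {z : ℂ} (hz : 0 < z.re) :
    ∫ x, Complex.exp (-z * x) ∂μ = Complex.exp (-t * laplaceExponent a α z) := by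
  refine integral_cexp_neg_mul_eq_of_real (analyticOnNhd_exp_neg_laplaceExponent t) ?_ ?_ hz
  · intro s hs
    refine (integrable_const (1 : ℝ)).mono' (by fun_prop) ?_
    filter_upwards [hμ0] with x hx
    rw [Real.norm_of_nonneg (Real.exp_pos _).le, Real.exp_le_one_iff]
    have := mul_nonneg hs.le hx
    linarith
  · intro s hs
    rw [hμ s hs, laplaceExponent_ofReal hs]
    push_cast
    rfl

/-- A measure on the half-line with Laplace transform `exp (-t Φ)` has the density given by the
Bromwich integral, which vanishes on the negative half-line. -/
theorem eq_withDensity_re_bromwich (hm : 1 ≤ m) (ha : ∀ j, 0 < a j)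
    (hα : ∀ j, α j ∈ Ioo (0 : ℝ) 1) (hμ0 : ∀ᵐ x ∂μ, 0 ≤ x) {t : ℝ} (ht : 0 < t)
    (hμ : ∀ s : ℝ, 0 < s → ∫ x, Real.exp (-s * x) ∂μ = Real.exp (-t * ∑ j, a j * s ^ α j)) :
    (∀ x, 0 ≤ (bromwich a α (fun _ => 1) x t).re) ∧
    (∀ x ≤ 0, (bromwich a α (fun _ => 1) x t).re = 0) ∧
    μ = (volume.restrict (Ioi 0)).withDensity
      fun x => ENNReal.ofReal (bromwich a α (fun _ => 1) x t).re := by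
  set B : ℝ → ℝ := fun x => (bromwich a α (fun _ => 1) x t).re with hB
  have hBc : Continuous B := Complex.continuous_re.comp
    (continuous_iff_continuousAt.2 fun x =>
      (hasDerivAt_bromwich_fst hm ha hα (isTame_const 1) x ht).continuousAt)
  have hexp : Measurable fun x : ℝ => ENNReal.ofReal (Real.exp (-x)) := by fun_prop
  -- Exponential tilting: the characteristic function of `ν` at `y` is the Laplace transform of `μ`
  -- at `1 - iy`, on the Bromwich line. The tilt is undone at the end by the density `exp x`.
  set ν := μ.withDensity fun x => ENNReal.ofReal (Real.exp (-x)) with hν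
  have hfin : IsFiniteMeasure ν := by
    refine isFiniteMeasure_withDensity_ofReal ?_
    refine ((integrable_const (1 : ℝ)).mono' (by fun_prop) ?_ :
      Integrable (fun x : ℝ => Real.exp (-x)) μ).2
    filter_upwards [hμ0] with x hx
    rw [Real.norm_of_nonneg (Real.exp_pos _).le, Real.exp_le_one_iff]
    linarith
  have hchar : ∀ y, charFun ν y
      = Complex.exp (-t * laplaceExponent a α (bromwichLine (-y))) := by
    intro y
    rw [← integral_cexp_neg_mul_eq_exp_laplaceExponent hμ0 hμ (bromwichLine_re_pos (-y)),
      charFun_apply_real, hν]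
    have hexp' : Measurable fun x : ℝ => Real.toNNReal (Real.exp (-x)) := by fun_prop
    have := integral_withDensity_eq_integral_smul (μ := μ) hexp'
      (fun x : ℝ => Complex.exp (y * x * Complex.I))
    refine this.trans (integral_congr_ae (.of_forall fun x => ?_))
    simp only [NNReal.smul_def, Real.coe_toNNReal _ (Real.exp_pos _).le, Complex.real_smul]
    push_cast
    rw [← Complex.exp_add, bromwichLine]
    congr 1
    push_cast
    ring
  have hinv : ∀ x, inverseCharFun (charFun ν) x
      = Real.exp (-x) * bromwich a α (fun _ => 1) x t := by
    intro x
    rw [inverseCharFun, bromwich, ← integral_neg_eq_self, mul_left_comm,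
      ← integral_const_mul (Real.exp (-x) : ℂ)]
    congr 1
    refine integral_congr_ae (.of_forall fun y => ?_)
    dsimp only
    rw [hchar, neg_neg, mul_one]
    push_cast
    rw [← Complex.exp_add, ← Complex.exp_add]
    congr 1
    rw [bromwichLine]
    ring
  have hchi : Integrable (charFun ν) := by
    have h := (integrable_bromwich_integrand hm ha hα (isTame_const 1) 0 ht).comp_neg
    refine h.congr (.of_forall fun y => ?_)
    dsimp only
    rw [hchar]
    simp
  have hIcc : ∀ c d : ℝ, c ≤ d → ν.real (Icc c d) = ∫ x in Icc c d, Real.exp (-x) * B x := by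
    intro c d hcd
    rw [measureReal_Icc_eq_integral_inverseCharFun hchi hcd]
    simp only [hinv, Complex.re_ofReal_mul, hB]
  have hg : Continuous fun x => Real.exp (-x) * B x := by fun_prop
  have hnn : ∀ x, 0 ≤ B x := by
    intro x
    have h := nonneg_of_forall_integral_Icc_nonneg hg (x := x) (by
      filter_upwards [self_mem_nhdsWithin] with δ hδ
      have hδ0 : 0 < δ := hδ
      rw [← hIcc _ _ (by linarith)]
      exact measureReal_nonneg)
    exact nonneg_of_mul_nonneg_right h (Real.exp_pos _)
  -- Small intervals around `x < 0` carry no mass, so `-B x ≥ 0` as well. Continuity then extends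
  -- the vanishing to `x = 0`, which will be the boundary condition.
  have hneg : ∀ x < 0, B x = 0 := by
    intro x hx
    refine le_antisymm ?_ (hnn x)
    have h := nonneg_of_forall_integral_Icc_nonneg hg.neg (x := x) (by
      filter_upwards [Ioo_mem_nhdsGT (neg_pos.2 hx)] with δ hδ
      simp only [Pi.neg_apply]
      rw [integral_neg, ← hIcc _ _ (by linarith [hδ.1])]
      have : ν.real (Icc (x - δ) (x + δ)) = 0 := by
        rw [measureReal_def, (withDensity_absolutelyContinuous μ _) (?_ : μ _ = 0),
          ENNReal.toReal_zero]
        refine measure_mono_null (fun y hy => ?_) hμ0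
        simp only [mem_compl_iff, mem_ofPred_eq, not_le]
        linarith [hy.2, hδ.2]
      rw [this, neg_zero])
    have := nonneg_of_mul_nonneg_right (show 0 ≤ Real.exp (-x) * (-B x) by simpa using h)
      (Real.exp_pos _)
    linarith
  have hnp : ∀ x ≤ 0, B x = 0 := by
    intro x hx
    have : closure (Iio (0 : ℝ)) ⊆ {x | B x = 0} :=
      closure_minimal hneg (isClosed_eq hBc continuous_const)
    rw [closure_Iio] at this
    exact this hx
  refine ⟨hnn, hnp, ?_⟩
  have hνeq : ν = volume.withDensity fun x => ENNReal.ofReal (Real.exp (-x) * B x) := by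
    refine Measure.ext_of_Icc _ _ fun c d hcd => ?_
    symm
    rw [withDensity_apply _ measurableSet_Icc, ← ofReal_integral_eq_lintegral_ofReal
      hg.integrableOn_Icc (.of_forall fun x => mul_nonneg (Real.exp_pos _).le (hnn x)),
      ← hIcc c d hcd, ofReal_measureReal]
  have hμν : μ = ν.withDensity fun x => ENNReal.ofReal (Real.exp x) := by
    rw [hν, ← withDensity_mul _ hexp (by fun_prop)]
    conv_lhs => rw [← withDensity_one (μ := μ)]
    congr with x
    rw [Pi.mul_apply, ← ENNReal.ofReal_mul (Real.exp_pos _).le, ← Real.exp_add]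
    simp
  rw [hμν, hνeq, ← withDensity_mul _ (by fun_prop) (by fun_prop), ← withDensity_indicator
    measurableSet_Ioi]
  congr with x
  rw [Pi.mul_apply, ← ENNReal.ofReal_mul (mul_nonneg (Real.exp_pos _).le (hnn x)),
    mul_right_comm, ← Real.exp_add, neg_add_cancel, Real.exp_zero, one_mul]
  by_cases hx : x ∈ Ioi (0 : ℝ)
  · rw [indicator_of_mem hx]
  · rw [indicator_of_notMem hx, hnp x (not_lt.1 hx), ENNReal.ofReal_zero]

end

section

variable {m : ℕ} {a α : Fin m → ℝ}

lemma continuous_re_bromwich (hm : 1 ≤ m) (ha : ∀ j, 0 < a j)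
    (hα : ∀ j, α j ∈ Ioo (0 : ℝ) 1) {G : ℂ → ℂ} (hG : IsTame G) {t : ℝ} (ht : 0 < t) :
    Continuous fun x => (bromwich a α G x t).re :=
  continuous_iff_continuousAt.2 fun x => (hasDerivAt_re_bromwich_fst hm ha hα hG x ht).continuousAt

lemma re_bromwich_laplaceExponent_mul (hm : 1 ≤ m) (ha : ∀ j, 0 < a j)
    (hα : ∀ j, α j ∈ Ioo (0 : ℝ) 1) {G : ℂ → ℂ} (hG : IsTame G) (x : ℝ) {t : ℝ} (ht : 0 < t) :
    (bromwich a α (fun s => laplaceExponent a α s * G s) x t).re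
      = ∑ j, a j * (bromwich a α (fun s => s ^ (α j : ℂ) * G s) x t).re := by
  rw [bromwich_congr (G := fun s => ∑ j, (a j : ℂ) * (s ^ (α j : ℂ) * G s)),
    bromwich_sum hm ha hα (fun j => (isTame_cpow (α j)).mul hG) a x ht, Complex.re_sum]
  · simp only [Complex.re_ofReal_mul]
  · intro s _
    simp only [laplaceExponent, Finset.sum_mul, mul_assoc]

end

/-! ### Processes with a given Laplace exponent, and their inverses -/

/-- A nondecreasing right-continuous process started at `0` whose one-dimensional marginals have
the Laplace exponent `∑ j, a j * s ^ α j`. -/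
structure HasLaplaceExponent {Ω : Type*} [MeasurableSpace Ω] {m : ℕ} (a α : Fin m → ℝ)
    (X : ℝ≥0 → Ω → ℝ) (P : Measure Ω) : Prop where
  aemeasurable : ∀ t, AEMeasurable (X t) P
  nonneg : ∀ t ω, 0 ≤ X t ω
  start_zero : ∀ᵐ ω ∂P, X 0 ω = 0
  monotone_paths : ∀ᵐ ω ∂P, Monotone fun t => X t ω
  rightCont_paths : ∀ᵐ ω ∂P, ∀ t, ContinuousWithinAt (fun s => X s ω) (Ici t) t
  laplace : ∀ (t : ℝ≥0) (s : ℝ), 0 < s →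
    ∫ ω, Real.exp (-s * X t ω) ∂P = Real.exp (-t * ∑ j, a j * s ^ α j)

namespace HasLaplaceExponent

variable {Ω : Type*} [MeasurableSpace Ω] {P : Measure Ω}
  {m : ℕ} {a α : Fin m → ℝ} {X : ℝ≥0 → Ω → ℝ}

lemma tendsto_zero (hX : HasLaplaceExponent a α X P) :
    ∀ᵐ ω ∂P, Tendsto (fun t : ℝ => X t.toNNReal ω) (𝓝[>] 0) (𝓝 0) := by
  filter_upwards [hX.start_zero, hX.rightCont_paths] with ω h0 hr
  have h := hr 0
  rw [ContinuousWithinAt, h0, show Ici (0 : ℝ≥0) = univ from Ici_bot, nhdsWithin_univ] at h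
  refine h.comp ?_
  have := continuous_real_toNNReal.tendsto 0
  rw [Real.toNNReal_zero] at this
  exact this.mono_left nhdsWithin_le_nhds

variable [IsProbabilityMeasure P]

lemma map_eq (hX : HasLaplaceExponent a α X P) (hm : 1 ≤ m) (ha : ∀ j, 0 < a j)
    (hα : ∀ j, α j ∈ Ioo (0 : ℝ) 1) {t : ℝ} (ht : 0 < t) :
    (∀ x, 0 ≤ (bromwich a α (fun _ => 1) x t).re) ∧
    (∀ x ≤ 0, (bromwich a α (fun _ => 1) x t).re = 0) ∧
    P.map (X t.toNNReal) = (volume.restrict (Ioi 0)).withDensity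
      fun x => ENNReal.ofReal (bromwich a α (fun _ => 1) x t).re := by
  have hXm := hX.aemeasurable t.toNNReal
  have : IsProbabilityMeasure (P.map (X t.toNNReal)) := Measure.isProbabilityMeasure_map hXm
  refine eq_withDensity_re_bromwich hm ha hα ?_ ht fun s hs => ?_
  · rw [ae_map_iff hXm measurableSet_Ici]
    exact .of_forall fun ω => hX.nonneg _ ω
  · rw [integral_map hXm (by fun_prop), hX.laplace _ s hs, Real.coe_toNNReal _ ht.le]

/-- The marginal densities solve the space-fractional equation. -/
theorem exists_solvesSpaceFractional (hX : HasLaplaceExponent a α X P) (hm : 1 ≤ m)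
    (ha : ∀ j, 0 < a j) (hα : ∀ j, α j ∈ Ioo (0 : ℝ) 1) :
    ∃ h : ℝ → ℝ → ℝ, IsLawDensity P X h ∧ SolvesSpaceFractional a α h := by
  refine ⟨fun x t => (bromwich a α (fun _ => 1) x t).re, ⟨?_, fun t ht => ?_⟩, ?_, ?_, ?_⟩
  · intro p hp
    exact (Complex.continuous_re.continuousAt.comp
      (continuousAt_bromwich hm ha hα (isTame_const 1) p.1 (t := p.2) hp.2)).continuousWithinAt
  · obtain ⟨h1, -, h3⟩ := hX.map_eq hm ha hα (NNReal.coe_pos.2 ht)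
    rw [Real.toNNReal_coe] at h3
    exact ⟨hX.aemeasurable t, fun x _ => h1 x, h3⟩
  · intro x _ t ht
    refine ⟨fun j => (bromwich a α (fun s => s ^ (α j : ℂ) * 1) x t).re, fun j => ?_, ?_⟩
    · exact hasRLDerivAt_re_bromwich hm ha hα (isTame_const 1) ht (hX.map_eq hm ha hα ht).2.1
        (hα j).2
    · rw [← re_bromwich_laplaceExponent_mul hm ha hα (isTame_const 1) x ht]
      exact hasDerivAt_re_bromwich_snd hm ha hα (isTame_const 1) x ht
  · intro φ
    -- The initial condition is `E φ(X t) → φ(0)`, by right-continuity of the paths at `0`.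
    have hlim : Tendsto (fun t : ℝ => ∫ ω, φ (X t.toNNReal ω) ∂P) (𝓝[>] 0)
        (𝓝 (∫ _, φ 0 ∂P)) := by
      refine tendsto_integral_filter_of_dominated_convergence (fun _ => ‖φ‖)
        (.of_forall fun t => ?_) (.of_forall fun t => .of_forall fun ω => φ.norm_coe_le_norm _)
        (integrable_const _) ?_
      · exact (φ.continuous.measurable.comp_aemeasurable
          (hX.aemeasurable _)).aestronglyMeasurable
      · filter_upwards [hX.tendsto_zero] with ω hω
        exact (φ.continuous.tendsto 0).comp hω
    rw [integral_const, probReal_univ, one_smul] at hlim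
    refine hlim.congr' ?_
    filter_upwards [self_mem_nhdsWithin] with t ht
    obtain ⟨h1, -, h3⟩ := hX.map_eq hm ha hα (t := t) ht
    rw [← integral_map (hX.aemeasurable _) φ.continuous.aestronglyMeasurable, h3]
    have hmeas : Measurable fun x => Real.toNNReal (bromwich a α (fun _ => 1) x t).re :=
      (continuous_re_bromwich hm ha hα (isTame_const 1) ht).measurable.real_toNNReal
    refine (integral_withDensity_eq_integral_smul hmeas φ).trans ?_
    refine integral_congr_ae (.of_forall fun x => ?_)
    simp only [NNReal.smul_def, Real.coe_toNNReal _ (h1 x), smul_eq_mul]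
    ring
  · intro t ht
    have h := (continuous_re_bromwich hm ha hα (isTame_const 1) ht).tendsto 0
    rw [(hX.map_eq hm ha hα ht).2.1 0 le_rfl] at h
    exact h.mono_left nhdsWithin_le_nhds

/-- Markov's inequality for `exp(-X n)` bounds the exceptional probability by `exp(t - nc)`, `c = ∑
a_j`. This matters because the infimum of the empty set in `ℝ≥0` is `0`: a level never reached would
give the inverse a spurious value. -/
lemma ae_exists_le (hX : HasLaplaceExponent a α X P) (hm : 1 ≤ m) (ha : ∀ j, 0 < a j) (t : ℝ) :
    ∀ᵐ ω ∂P, ∃ n : ℕ, t ≤ X n ω := by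
  set c := ∑ j, a j with hc
  have hc0 : 0 < c := Finset.sum_pos (fun j _ => ha j) ⟨⟨0, hm⟩, Finset.mem_univ _⟩
  have hb : ∀ n : ℕ, P.real {ω | ¬ ∃ n : ℕ, t ≤ X n ω} ≤ Real.exp t * Real.exp (-n * c) := by
    intro n
    have hi : Integrable (fun ω => Real.exp (-1 * X n ω)) P := by
      refine (integrable_const (1 : ℝ)).mono' ?_ (.of_forall fun ω => ?_)
      · have := hX.aemeasurable n
        exact AEMeasurable.aestronglyMeasurable (by fun_prop)
      · rw [Real.norm_of_nonneg (Real.exp_pos _).le, Real.exp_le_one_iff]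
        linarith [hX.nonneg n ω]
    have h1 := mul_meas_ge_le_integral_of_nonneg (.of_forall fun ω => (Real.exp_pos _).le) hi
      (Real.exp (-t))
    rw [hX.laplace _ 1 one_pos] at h1
    simp only [Real.one_rpow, mul_one, NNReal.coe_natCast] at h1
    have h2 : P.real {ω | ¬ ∃ n : ℕ, t ≤ X n ω}
        ≤ P.real {ω | Real.exp (-t) ≤ Real.exp (-1 * X n ω)} := by
      refine measureReal_mono fun ω hω => ?_
      simp only [mem_ofPred_eq, not_exists, not_le] at hω ⊢
      exact Real.exp_le_exp.2 (by linarith [hω n])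
    have h3 : Real.exp t * Real.exp (-t) = 1 := by rw [← Real.exp_add]; simp
    calc _ ≤ P.real {ω | Real.exp (-t) ≤ Real.exp (-1 * X n ω)} := h2
      _ = Real.exp t * (Real.exp (-t) * P.real {ω | Real.exp (-t) ≤ Real.exp (-1 * X n ω)}) := by
          rw [← mul_assoc, h3, one_mul]
      _ ≤ _ := mul_le_mul_of_nonneg_left h1 (Real.exp_pos t).le
  have hlim : Tendsto (fun n : ℕ => Real.exp t * Real.exp (-n * c)) atTop (𝓝 (Real.exp t * 0)) := by
    refine (Real.tendsto_exp_atBot.comp ?_).const_mul _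
    simp only [neg_mul]
    exact tendsto_neg_atTop_atBot.comp (tendsto_natCast_atTop_atTop.atTop_mul_const hc0)
  rw [mul_zero] at hlim
  have h0 := ge_of_tendsto' hlim hb
  rw [ae_iff]
  exact (measureReal_eq_zero_iff).1 (le_antisymm h0 measureReal_nonneg)

/-- The inverse of the process is at most `x` iff the process has passed the level at time `x`. -/
lemma ae_inverseProcess_le_iff (hX : HasLaplaceExponent a α X P) (hm : 1 ≤ m)
    (ha : ∀ j, 0 < a j) {t : ℝ≥0} (ht : 0 < t) :
    ∀ᵐ ω ∂P, ∀ x : ℝ≥0, 0 < x → (inverseProcess X t ω ≤ x ↔ (t : ℝ) ≤ X x ω) := by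
  filter_upwards [hX.ae_exists_le hm ha t, hX.start_zero, hX.monotone_paths, hX.rightCont_paths]
    with ω ⟨n, hn⟩ h0 hmono hr x hx
  have hne : {s : ℝ≥0 | 0 < s ∧ (t : ℝ) ≤ X s ω}.Nonempty := by
    refine ⟨n, pos_iff_ne_zero.2 fun h => ?_, hn⟩
    rw [h, h0] at hn
    exact absurd hn (not_le.2 (by exact_mod_cast ht))
  rw [inverseProcess, NNReal.coe_le_coe]
  constructor
  · intro h
    -- Monotonicity gives the level at every time after `x`; right-continuity brings it back to `x`
    -- itself.
    have hgt : ∀ y ∈ Ioi x, (t : ℝ) ≤ X y ω := by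
      intro y hy
      obtain ⟨s, hs, hsy⟩ := exists_lt_of_csInf_lt hne (lt_of_le_of_lt h hy)
      exact hs.2.trans (hmono hsy.le)
    have hc : Tendsto (fun s => X s ω) (𝓝[>] x) (𝓝 (X x ω)) :=
      (hr x).mono_left (nhdsWithin_mono _ Ioi_subset_Ici_self)
    exact ge_of_tendsto hc (by filter_upwards [self_mem_nhdsWithin] with y hy using hgt y hy)
  · intro h
    exact csInf_le (OrderBot.bddBelow _) ⟨hx, h⟩

/-- Serves twice: the inverse has no mass at `0`, and its distribution function is right-continuous
there. -/
lemma tendsto_measureReal_le (hX : HasLaplaceExponent a α X P) {t : ℝ} (ht : 0 < t) :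
    Tendsto (fun x : ℝ => P.real {ω | t ≤ X x.toNNReal ω}) (𝓝[>] 0) (𝓝 0) := by
  have hns : ∀ x : ℝ≥0, NullMeasurableSet {ω | t ≤ X x ω} P := fun x =>
    (hX.aemeasurable x).nullMeasurable measurableSet_Ici
  have h : Tendsto (fun x : ℝ => ∫ ω, {ω | t ≤ X x.toNNReal ω}.indicator (fun _ => (1 : ℝ)) ω ∂P)
      (𝓝[>] 0) (𝓝 (∫ _, (0 : ℝ) ∂P)) := by
    refine tendsto_integral_filter_of_dominated_convergence (fun _ => 1) (.of_forall fun x => ?_)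
      (.of_forall fun x => .of_forall fun ω => ?_) (integrable_const _) ?_
    · exact aestronglyMeasurable_const.indicator₀ (hns _)
    · exact (norm_indicator_le_norm_self _ _).trans (by simp)
    · filter_upwards [hX.tendsto_zero] with ω hω
      refine tendsto_const_nhds.congr' ?_
      filter_upwards [hω.eventually (gt_mem_nhds ht)] with x hx
      rw [indicator_of_notMem]
      simpa using hx
  simp only [integral_zero] at h
  refine h.congr fun x => ?_
  rw [integral_indicator₀ (hns _)]
  simp

/-- For `c > 0` the event `{L ≤ c}` agrees with `{X c ≥ t}` only up to a null set, so the argument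
runs through null-measurable sets; for `c ≤ 0` the event is null. -/
lemma aemeasurable_inverseProcess (hX : HasLaplaceExponent a α X P) (hm : 1 ≤ m)
    (ha : ∀ j, 0 < a j) {t : ℝ≥0} (ht : 0 < t) :
    AEMeasurable (inverseProcess X t) P ∧ P {ω | inverseProcess X t ω ≤ 0} = 0 := by
  have hiff := hX.ae_inverseProcess_le_iff hm ha ht
  have heq : ∀ x : ℝ, 0 < x →
      {ω | inverseProcess X t ω ≤ x} =ᵐ[P] {ω | (t : ℝ) ≤ X x.toNNReal ω} := by
    intro x hx
    filter_upwards [hiff] with ω hω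
    have := hω x.toNNReal (Real.toNNReal_pos.2 hx)
    rw [Real.coe_toNNReal _ hx.le] at this
    exact propext this
  have hzero : P {ω | inverseProcess X t ω ≤ 0} = 0 := by
    rw [← measureReal_eq_zero_iff]
    refine le_antisymm (ge_of_tendsto (hX.tendsto_measureReal_le (NNReal.coe_pos.2 ht)) ?_)
      measureReal_nonneg
    filter_upwards [self_mem_nhdsWithin] with x hx
    rw [← measureReal_congr (heq x hx)]
    exact measureReal_mono fun ω (hω : _ ≤ (0 : ℝ)) => hω.trans (le_of_lt hx)
  refine ⟨NullMeasurable.aemeasurable ?_, hzero⟩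
  have : @Measurable (NullMeasurableSpace Ω P) ℝ _ _ (inverseProcess X t) := by
    refine measurable_of_Iic fun c => ?_
    change NullMeasurableSet {ω | inverseProcess X t ω ≤ c} P
    rcases lt_or_ge 0 c with hc | hc
    · exact ((hX.aemeasurable c.toNNReal).nullMeasurable measurableSet_Ici).congr (heq c hc).symm
    · exact NullMeasurableSet.of_null (measure_mono_null (fun ω hω => le_trans hω hc) hzero)
  exact this

end HasLaplaceExponent

namespace HasLaplaceExponent

variable {Ω : Type*} [MeasurableSpace Ω] {P : Measure Ω} [IsProbabilityMeasure P]
  {m : ℕ} {a α : Fin m → ℝ} {X : ℝ≥0 → Ω → ℝ}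

/-- Ordinary integration over `(0, t)` is the power kernel with `b = 1`, hence the factor `s^(-1)`.
-/
lemma measureReal_le_eq (hX : HasLaplaceExponent a α X P) (hm : 1 ≤ m) (ha : ∀ j, 0 < a j)
    (hα : ∀ j, α j ∈ Ioo (0 : ℝ) 1) {x : ℝ} (hx : 0 < x) (t : ℝ) :
    P.real {ω | t ≤ X x.toNNReal ω}
      = 1 - (bromwich a α (fun s => s ^ (-(1 : ℝ) : ℂ) * 1) t x).re := by
  obtain ⟨h1, h2, h3⟩ := hX.map_eq hm ha hα hx
  have hXm := hX.aemeasurable x.toNNReal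
  have : IsProbabilityMeasure (P.map (X x.toNNReal)) := Measure.isProbabilityMeasure_map hXm
  have hI := integral_Ioo_re_bromwich_mul_rpow hm ha hα (isTame_const 1) hx h2 one_pos t
  simp only [sub_self, Real.rpow_zero, mul_one, Real.Gamma_one, one_mul] at hI
  have e : P.real {ω | t ≤ X x.toNNReal ω} = (P.map (X x.toNNReal)).real (Iio t)ᶜ := by
    rw [measureReal_def, measureReal_def, Measure.map_apply_of_aemeasurable hXm
      measurableSet_Iio.compl]
    congr 2
    ext ω
    simp
  rw [e, probReal_compl_eq_one_sub measurableSet_Iio, measureReal_def, h3,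
    withDensity_apply _ measurableSet_Iio, Measure.restrict_restrict measurableSet_Iio,
    Iio_inter_Ioi, ← ofReal_integral_eq_lintegral_ofReal hI.1 (.of_forall fun u => h1 u), hI.2,
    ENNReal.toReal_ofReal]
  · simp
  · rw [← hI.2]
    exact integral_nonneg fun u => h1 u

/-- Exhibits the inverse density as a positive combination of fractional integrals of order `1 - α
j` of the density of `X`, from which it inherits its sign and its support. -/
lemma re_bromwich_sum_mul_cpow_sub_one (hm : 1 ≤ m) (ha : ∀ j, 0 < a j)
    (hα : ∀ j, α j ∈ Ioo (0 : ℝ) 1) (t : ℝ) {x : ℝ} (hx : 0 < x) :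
    (bromwich a α (fun s => ∑ j, (a j : ℂ) * s ^ ((α j - 1 : ℝ) : ℂ)) t x).re
      = ∑ j, a j * (bromwich a α (fun s => s ^ (-(1 - α j : ℝ) : ℂ) * 1) t x).re := by
  rw [bromwich_sum hm ha hα (fun j => isTame_cpow (α j - 1)) a t hx, Complex.re_sum]
  refine Finset.sum_congr rfl fun j _ => ?_
  rw [Complex.re_ofReal_mul]
  congr 2
  refine bromwich_congr (fun s _ => ?_) t x
  rw [mul_one]
  push_cast
  ring_nf

/-- The densities of the inverse process solve the time-fractional equation. -/
theorem exists_solvesTimeFractional (hX : HasLaplaceExponent a α X P) (hm : 1 ≤ m)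
    (ha : ∀ j, 0 < a j) (hα : ∀ j, α j ∈ Ioo (0 : ℝ) 1) :
    ∃ l : ℝ → ℝ → ℝ, IsLawDensity P (inverseProcess X) l ∧ SolvesTimeFractional a α l := by
  set R : ℂ → ℂ := fun s => ∑ j, (a j : ℂ) * s ^ ((α j - 1 : ℝ) : ℂ) with hR
  have tR : IsTame R := isTame_sum_mul_cpow _ _
  have hα' : ∀ j, 0 < 1 - α j := fun j => by linarith [(hα j).2]
  have hnn : ∀ t, ∀ x > 0, 0 ≤ (bromwich a α R t x).re := by
    intro t x hx
    rw [re_bromwich_sum_mul_cpow_sub_one hm ha hα t hx]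
    exact Finset.sum_nonneg fun j _ => mul_nonneg (ha j).le
      (re_bromwich_rpow_mul_nonneg hm ha hα (isTame_const 1) hx (hX.map_eq hm ha hα hx).1 (hα' j) t)
  have hzero : ∀ x > 0, ∀ t ≤ 0, (bromwich a α R t x).re = 0 := by
    intro x hx t ht
    rw [re_bromwich_sum_mul_cpow_sub_one hm ha hα t hx]
    refine Finset.sum_eq_zero fun j _ => ?_
    rw [re_bromwich_rpow_mul_eq_zero hm ha hα (isTame_const 1) hx (hX.map_eq hm ha hα hx).2.1
      (hα' j) t ht, mul_zero]
  have hcont : ∀ t, ∀ x > 0, ContinuousAt (fun p : ℝ × ℝ => (bromwich a α R p.1 p.2).re) (t, x) :=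
    fun t x hx => Complex.continuous_re.continuousAt.comp (continuousAt_bromwich hm ha hα tR t hx)
  refine ⟨fun x t => (bromwich a α R t x).re, ⟨?_, fun t ht => ?_⟩, ?_, ?_⟩
  · intro p hp
    exact (ContinuousAt.comp (f := fun p : ℝ × ℝ => (p.2, p.1)) (x := p) (hcont p.2 p.1 hp.1)
      continuous_swap.continuousAt).continuousWithinAt
  · obtain ⟨hLm, hL0⟩ := hX.aemeasurable_inverseProcess hm ha ht
    refine ⟨hLm, fun x hx => hnn t x hx, ?_⟩
    have : IsProbabilityMeasure (P.map (inverseProcess X t)) := Measure.isProbabilityMeasure_map hLm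
    refine Measure.ext_of_Iic _ _ fun c => ?_
    rw [Measure.map_apply_of_aemeasurable hLm measurableSet_Iic, withDensity_apply _
      measurableSet_Iic, Measure.restrict_restrict measurableSet_Iic, inter_comm, Ioi_inter_Iic]
    rcases le_or_gt c 0 with hc | hc
    · rw [Ioc_eq_empty (not_lt.2 hc), Measure.restrict_empty, lintegral_zero_measure]
      exact measure_mono_null (fun ω (hω : _ ≤ c) => hω.trans hc) hL0
    · set F : ℝ → ℝ := fun x => P.real {ω | (t : ℝ) ≤ X x.toNNReal ω} with hF
      have hF0 : F 0 = 0 := by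
        rw [hF]
        dsimp only
        rw [measureReal_eq_zero_iff, Real.toNNReal_zero]
        refine measure_mono_null (fun ω hω => ?_) hX.start_zero
        simp only [mem_compl_iff, mem_ofPred_eq] at hω ⊢
        intro h
        rw [h] at hω
        exact absurd hω (not_le.2 (by exact_mod_cast ht))
      -- Differentiating `1 - B_{1/s}` in `x` brings down `Φ`, the two signs cancel, and `Φ/s = R`.
      have hFd : ∀ x > 0, HasDerivAt F (bromwich a α R t x).re x := by
        intro x hx
        have h := (hasDerivAt_re_bromwich_snd hm ha hα
          ((isTame_cpow (-(1 : ℝ))).mul (isTame_const 1)) (t : ℝ) hx).const_sub 1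
        rw [neg_neg, bromwich_congr (G := R)] at h
        · refine h.congr_of_eventuallyEq ?_
          filter_upwards [Ioi_mem_nhds hx] with y hy
          rw [hF]
          dsimp only
          rw [hX.measureReal_le_eq hm ha hα hy]
          push_cast
          rfl
        · intro s hs
          have hs0 : s ≠ 0 := by rintro rfl; simp at hs
          have := mul_sum_mul_cpow_sub_one a α hs0
          rw [laplaceExponent, ← this, mul_one, mul_right_comm]
          push_cast
          rw [Complex.cpow_neg_one, mul_inv_cancel₀ hs0, one_mul, hR]
          push_cast
          rfl
      have hFc : ContinuousOn F (Icc 0 c) := by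
        intro x hx
        rcases eq_or_lt_of_le hx.1 with h0 | h0
        · subst h0
          have h1 : ContinuousWithinAt F (Ioi 0) 0 := by
            rw [ContinuousWithinAt, hF0]
            exact hX.tendsto_measureReal_le (NNReal.coe_pos.2 ht)
          exact (continuousWithinAt_Ioi_iff_Ici.1 h1).mono Icc_subset_Ici_self
        · exact (hFd x h0).continuousAt.continuousWithinAt
      -- No bound near `x = 0` is needed: a nonnegative derivative of a function continuous up to
      -- the endpoint is integrable.
      have hint : IntegrableOn (fun x => (bromwich a α R t x).re) (Ioc 0 c) :=
        intervalIntegral.integrableOn_deriv_of_nonneg hFc (fun x hx => hFd x hx.1)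
          fun x hx => hnn t x hx.1
      have hftc := intervalIntegral.integral_eq_sub_of_hasDerivAt_of_le hc.le hFc
        (fun x hx => hFd x hx.1) ((intervalIntegrable_iff_integrableOn_Ioc_of_le hc.le).2 hint)
      rw [hF0, sub_zero, intervalIntegral.integral_of_le hc.le] at hftc
      rw [← ofReal_integral_eq_lintegral_ofReal hint ((ae_restrict_iff' measurableSet_Ioc).2
        (.of_forall fun x hx => hnn t x hx.1)), hftc, hF, ofReal_measureReal]
      refine measure_congr ?_
      filter_upwards [hX.ae_inverseProcess_le_iff hm ha ht] with ω hω
      have := hω c.toNNReal (Real.toNNReal_pos.2 hc)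
      rw [Real.coe_toNNReal _ hc.le] at this
      exact propext this
  · intro x hx t _
    refine ⟨fun j => (bromwich a α (fun s => s ^ (α j : ℂ) * R s) t x).re, fun j => ?_, ?_⟩
    · exact hasRLDerivAt_re_bromwich hm ha hα tR hx (hzero x hx) (hα j).2
    · rw [← re_bromwich_laplaceExponent_mul hm ha hα tR t hx]
      exact hasDerivAt_re_bromwich_snd hm ha hα tR t hx
  · intro t ht
    exact tendsto_re_bromwich_nhdsGT_zero hm ha hα ht

end HasLaplaceExponent

/-! ### Composition of paths and its measurability -/

section Paths

variable {Ω : Type*} {r : ℕ} {H : Fin r → ℝ≥0 → Ω → ℝ≥0} {ω : Ω}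

lemma iterComp_zero_time (h : ∀ k, H k 0 ω = 0) : iterComp r H 0 ω = 0 := by
  induction r with
  | zero => rfl
  | succ r ih => rw [iterComp, ih fun k => h k.succ, h 0]

lemma monotone_iterComp (h : ∀ k, Monotone fun t => H k t ω) :
    Monotone fun t => iterComp r H t ω := by
  induction r with
  | zero => exact monotone_id
  | succ r ih => exact fun s t hst => h 0 (ih (fun k => h k.succ) hst)

/-- Right-continuity survives composition because the inner path, being monotone, approaches its
limit from the right. -/
lemma continuousWithinAt_iterComp (h : ∀ k, Monotone fun t => H k t ω)
    (hc : ∀ k t, ContinuousWithinAt (fun s => H k s ω) (Ici t) t) (t : ℝ≥0) :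
    ContinuousWithinAt (fun s => iterComp r H s ω) (Ici t) t := by
  induction r with
  | zero => exact continuousWithinAt_id
  | succ r ih =>
    exact (hc 0 _).comp (ih (fun k => h k.succ) fun k => hc k.succ) fun s hs =>
      monotone_iterComp (fun k => h k.succ) hs

/-- The grid point `(k + 1) / (n + 1)`; with `k = ⌊(n + 1) x⌋` it approximates `x` from the right. -/
noncomputable def approxRight (n : ℕ) (k : ℕ) : ℝ≥0 := (k + 1) / (n + 1)

lemma lt_approxRight (n : ℕ) (x : ℝ≥0) : x < approxRight n ⌊(n + 1) * x⌋₊ := by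
  rw [approxRight, lt_div_iff₀ (by positivity), mul_comm]
  exact Nat.lt_floor_add_one _

lemma tendsto_approxRight (x : ℝ≥0) :
    Tendsto (fun n : ℕ => approxRight n ⌊(n + 1) * x⌋₊) atTop (𝓝[≥] x) := by
  refine tendsto_nhdsWithin_iff.2 ⟨?_, .of_forall fun n => (lt_approxRight n x).le⟩
  have h1 : Tendsto (fun n : ℕ => x + 1 / ((n : ℝ≥0) + 1)) atTop (𝓝 (x + 0)) :=
    tendsto_const_nhds.add tendsto_one_div_add_atTop_nhds_zero_nat
  rw [add_zero] at h1
  refine tendsto_of_tendsto_of_tendsto_of_le_of_le tendsto_const_nhds h1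
    (fun n => (lt_approxRight n x).le) fun n => ?_
  rw [approxRight, div_le_iff₀ (by positivity), add_mul x, one_div,
    inv_mul_cancel₀ (by positivity), mul_comm x]
  gcongr
  exact Nat.floor_le (zero_le)

/-- A measurable functional on the path space which computes the iterated composition of
right-continuous paths. -/
noncomputable def pathComp : (r : ℕ) → ℝ≥0 → (Fin r → ℝ≥0 → ℝ≥0) → ℝ≥0
  | 0, t, _ => t
  | r + 1, t, p => limsup (fun n : ℕ =>
      p 0 (approxRight n ⌊(n + 1) * pathComp r t (fun k => p k.succ)⌋₊)) atTop

lemma measurable_eval_approxRight {S : Type*} [MeasurableSpace S] {N : S → ℕ} (hN : Measurable N)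
    {Z : S → ℝ≥0 → ℝ≥0} (hZ : Measurable Z) (n : ℕ) :
    Measurable fun ω => Z ω (approxRight n (N ω)) := by
  have : Measurable fun p : ℕ × (ℝ≥0 → ℝ≥0) => p.2 (approxRight n p.1) :=
    measurable_from_prod_countable_right fun k =>
      measurable_pi_apply (approxRight n k)
  exact this.comp (hN.prodMk hZ)

/-- Evaluating an arbitrary path at a variable time is not jointly measurable for the product
σ-algebra. `pathComp` reads each path on countable grids only, so independence of the paths can be
transported through it. -/
lemma measurable_pathComp (r : ℕ) (t : ℝ≥0) : Measurable (pathComp r t) := by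
  induction r with
  | zero => exact measurable_const
  | succ r ih =>
    refine Measurable.limsup fun n => ?_
    refine measurable_eval_approxRight (Nat.measurable_floor.comp (measurable_const.mul (ih.comp ?_)))
      (measurable_pi_apply 0) n
    exact measurable_pi_iff.2 fun k => measurable_pi_apply _

lemma pathComp_eq_iterComp (hc : ∀ k t, ContinuousWithinAt (fun s => H k s ω) (Ici t) t) (t : ℝ≥0) :
    pathComp r t (fun k s => H k s ω) = iterComp r H t ω := by
  induction r with
  | zero => rfl
  | succ r ih =>
    rw [pathComp, iterComp, ih fun k => hc k.succ]
    exact ((hc 0 _).tendsto.comp (tendsto_approxRight _)).limsup_eq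

end Paths

/-! ### Laplace transforms of compositions and of their weighted sum -/

section Laplace

variable {Ω : Type*} [MeasurableSpace Ω] {P : Measure Ω}

lemma IsStableSubordinator.measurable_path {ν : ℝ} {Z : ℝ≥0 → Ω → ℝ≥0}
    (hZ : IsStableSubordinator ν Z P) : Measurable fun ω t => Z t ω :=
  measurable_pi_iff.2 hZ.measurable

lemma ae_pathComp_eq_iterComp {ν : ℝ} {r : ℕ} {H : Fin r → ℝ≥0 → Ω → ℝ≥0}
    (hH : ∀ k, IsStableSubordinator ν (H k) P) (t : ℝ≥0) :
    ∀ᵐ ω ∂P, pathComp r t (fun k s => H k s ω) = iterComp r H t ω := by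
  filter_upwards [ae_all_iff.2 fun k => (hH k).rightCont_paths] with ω hω
  exact pathComp_eq_iterComp hω t

lemma measurable_pathComp_comp {ν : ℝ} {r : ℕ} {H : Fin r → ℝ≥0 → Ω → ℝ≥0}
    (hH : ∀ k, IsStableSubordinator ν (H k) P) (t : ℝ≥0) :
    Measurable fun ω => pathComp r t (fun k s => H k s ω) :=
  (measurable_pathComp r t).comp (measurable_pi_iff.2 fun k => (hH k).measurable_path)

lemma IsStableSubordinator.laplace {ν : ℝ} {Z : ℝ≥0 → Ω → ℝ≥0}
    (hZ : IsStableSubordinator ν Z P) (t : ℝ≥0) {s : ℝ} (hs : 0 ≤ s) :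
    ∫ ω, Real.exp (-s * (Z t ω : ℝ)) ∂P = Real.exp (-(t : ℝ) * s ^ ν) := by
  have h := hZ.laplace_increments 0 t (zero_le) s hs
  rw [NNReal.coe_zero, sub_zero] at h
  rw [← h]
  refine integral_congr_ae ?_
  filter_upwards [hZ.start_zero] with ω hω
  simp [hω]

variable [IsProbabilityMeasure P]

lemma integrable_exp_neg_mul {f : Ω → ℝ} (hf : AEMeasurable f P) (h0 : ∀ ω, 0 ≤ f ω) {s : ℝ}
    (hs : 0 ≤ s) : Integrable (fun ω => Real.exp (-s * f ω)) P := by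
  refine (integrable_const (1 : ℝ)).mono' (AEMeasurable.aestronglyMeasurable (by fun_prop))
    (.of_forall fun ω => ?_)
  rw [Real.norm_of_nonneg (Real.exp_pos _).le, Real.exp_le_one_iff]
  have := mul_nonneg hs (h0 ω)
  linarith

/-- Subordination: the Laplace transform of a stable subordinator evaluated at an independent
random time. -/
lemma IsStableSubordinator.laplace_comp {ν : ℝ} {Z : ℝ≥0 → Ω → ℝ≥0}
    (hZ : IsStableSubordinator ν Z P) {Y : Ω → ℝ≥0} (hY : Measurable Y)
    (hind : IndepFun Y (fun ω t => Z t ω) P) {s : ℝ} (hs : 0 ≤ s) :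
    ∫ ω, Real.exp (-s * (Z (Y ω) ω : ℝ)) ∂P = ∫ ω, Real.exp (-s ^ ν * (Y ω : ℝ)) ∂P := by
  have hN : ∀ n : ℕ, Measurable fun ω => ⌊((n : ℝ≥0) + 1) * Y ω⌋₊ := fun n =>
    Nat.measurable_floor.comp (measurable_const.mul hY)
  have hsν : 0 ≤ s ^ ν := Real.rpow_nonneg hs ν
  -- At a grid-valued time only the index `N` is random: Fubini on the product law of `N` and the
  -- path reduces to the transform at a fixed time. Right-continuity and the bound `1` then let the
  -- mesh tend to zero.
  have hdisc : ∀ n : ℕ,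
      ∫ ω, Real.exp (-s * (Z (approxRight n ⌊(n + 1) * Y ω⌋₊) ω : ℝ)) ∂P
        = ∫ ω, Real.exp (-s ^ ν * (approxRight n ⌊(n + 1) * Y ω⌋₊ : ℝ)) ∂P := by
    intro n
    set N : Ω → ℕ := fun ω => ⌊((n : ℝ≥0) + 1) * Y ω⌋₊ with hNdef
    have hNZ : IndepFun N (fun ω t => Z t ω) P :=
      hind.comp (φ := fun x => ⌊((n : ℝ≥0) + 1) * x⌋₊)
        (Nat.measurable_floor.comp (measurable_const.mul measurable_id)) measurable_id
    have hmap := (indepFun_iff_map_prod_eq_prod_map_map (hN n).aemeasurable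
      hZ.measurable_path.aemeasurable).1 hNZ
    have hprobN : IsProbabilityMeasure (P.map N) :=
      Measure.isProbabilityMeasure_map (hN n).aemeasurable
    have hprobZ : IsProbabilityMeasure (P.map fun ω t => Z t ω) :=
      Measure.isProbabilityMeasure_map hZ.measurable_path.aemeasurable
    have hg : Measurable fun p : ℕ × (ℝ≥0 → ℝ≥0) => ((p.2 (approxRight n p.1) : ℝ≥0) : ℝ) :=
      (measurable_eval_approxRight measurable_fst measurable_snd n).coe_nnreal_real
    have hge : Measurable fun p : ℕ × (ℝ≥0 → ℝ≥0) =>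
        Real.exp (-s * ((p.2 (approxRight n p.1) : ℝ≥0) : ℝ)) := by fun_prop
    calc ∫ ω, Real.exp (-s * (Z (approxRight n (N ω)) ω : ℝ)) ∂P
        = ∫ p, Real.exp (-s * ((p.2 (approxRight n p.1) : ℝ≥0) : ℝ))
            ∂(P.map fun ω => (N ω, fun t => Z t ω)) :=
          (integral_map ((hN n).prodMk hZ.measurable_path).aemeasurable
            hge.aestronglyMeasurable).symm
      _ = ∫ k, ∫ z, Real.exp (-s * ((z (approxRight n k) : ℝ≥0) : ℝ))
            ∂(P.map fun ω t => Z t ω) ∂(P.map N) := by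
          rw [hmap, integral_prod]
          exact integrable_exp_neg_mul hg.aemeasurable (fun p => NNReal.coe_nonneg _) hs
      _ = ∫ k, Real.exp (-s ^ ν * (approxRight n k : ℝ)) ∂(P.map N) := by
          congr with k
          have hk : Measurable fun z : ℝ≥0 → ℝ≥0 =>
              Real.exp (-s * ((z (approxRight n k) : ℝ≥0) : ℝ)) := by fun_prop
          rw [integral_map hZ.measurable_path.aemeasurable hk.aestronglyMeasurable,
            hZ.laplace _ hs]
          ring_nf
      _ = _ := integral_map (hN n).aemeasurable (measurable_from_nat).aestronglyMeasurable
  have hle : ∀ {c x : ℝ}, 0 ≤ c → 0 ≤ x → ‖Real.exp (-c * x)‖ ≤ 1 := by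
    intro c x hc hx
    rw [Real.norm_of_nonneg (Real.exp_pos _).le, Real.exp_le_one_iff]
    have := mul_nonneg hc hx
    linarith
  have l1 : Tendsto (fun n : ℕ =>
      ∫ ω, Real.exp (-s * (Z (approxRight n ⌊(n + 1) * Y ω⌋₊) ω : ℝ)) ∂P) atTop
      (𝓝 (∫ ω, Real.exp (-s * (Z (Y ω) ω : ℝ)) ∂P)) := by
    refine tendsto_integral_of_dominated_convergence (fun _ => 1) (fun n => ?_)
      (integrable_const _) (fun n => .of_forall fun ω => hle hs (NNReal.coe_nonneg _)) ?_
    · have := (measurable_eval_approxRight (hN n) hZ.measurable_path n).coe_nnreal_real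
      exact Measurable.aestronglyMeasurable (by fun_prop)
    · filter_upwards [hZ.rightCont_paths] with ω hω
      have h : Tendsto (fun n : ℕ => Z (approxRight n ⌊(n + 1) * Y ω⌋₊) ω) atTop
          (𝓝 (Z (Y ω) ω)) := (hω (Y ω)).tendsto.comp (tendsto_approxRight _)
      exact (Real.continuous_exp.tendsto _).comp
        (((NNReal.continuous_coe.tendsto _).comp h).const_mul _)
  have l2 : Tendsto (fun n : ℕ =>
      ∫ ω, Real.exp (-s ^ ν * (approxRight n ⌊(n + 1) * Y ω⌋₊ : ℝ)) ∂P) atTop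
      (𝓝 (∫ ω, Real.exp (-s ^ ν * (Y ω : ℝ)) ∂P)) := by
    refine tendsto_integral_of_dominated_convergence (fun _ => 1) (fun n => ?_)
      (integrable_const _) (fun n => .of_forall fun ω => hle hsν (NNReal.coe_nonneg _)) ?_
    · exact ((measurable_from_nat (f := fun k =>
        Real.exp (-s ^ ν * (approxRight n k : ℝ)))).comp (hN n)).aestronglyMeasurable
    · refine .of_forall fun ω => ?_
      have h := (tendsto_approxRight (Y ω)).mono_right nhdsWithin_le_nhds
      exact (Real.continuous_exp.tendsto _).comp
        (((NNReal.continuous_coe.tendsto _).comp h).const_mul _)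
  exact tendsto_nhds_unique (l1.congr hdisc) l2

/-- The iterated composition of `r` independent stable subordinators of order `ν` has the
marginals of a stable subordinator of order `ν ^ r`. -/
lemma laplace_iterComp {ν : ℝ} {r : ℕ} {H : Fin r → ℝ≥0 → Ω → ℝ≥0}
    (hH : ∀ k, IsStableSubordinator ν (H k) P)
    (hind : iIndepFun (fun (k : Fin r) (ω : Ω) (t : ℝ≥0) => H k t ω) P) (t : ℝ≥0) {s : ℝ}
    (hs : 0 ≤ s) :
    ∫ ω, Real.exp (-s * (iterComp r H t ω : ℝ)) ∂P = Real.exp (-(t : ℝ) * s ^ (ν ^ r)) := by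
  induction r generalizing s with
  | zero =>
    simp only [iterComp, pow_zero, Real.rpow_one, integral_const, probReal_univ, one_smul]
    ring_nf
  | succ r ih =>
    have hind' : iIndepFun (fun (k : Fin r) (ω : Ω) (t : ℝ≥0) => H k.succ t ω) P :=
      hind.precomp (Fin.succ_injective r)
    have hY := measurable_pathComp_comp (fun k : Fin r => hH k.succ) t
    have hYeq := ae_pathComp_eq_iterComp (fun k : Fin r => hH k.succ) t
    -- The inner composition depends only on the paths of index at least `1`, hence is independent
    -- of the outermost process.
    have h1 := hind.indepFun_finset {0}ᶜ {0} (by simp) fun k => (hH k).measurable_path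
    have h2 : IndepFun (fun ω => pathComp r t (fun k s => H k.succ s ω)) (fun ω t => H 0 t ω) P :=
      h1.comp (φ := fun p : (({0}ᶜ : Finset (Fin (r + 1))) → ℝ≥0 → ℝ≥0) =>
          pathComp r t fun k => p ⟨k.succ, by simp⟩)
        (ψ := fun p : (({0} : Finset (Fin (r + 1))) → ℝ≥0 → ℝ≥0) => p ⟨0, by simp⟩)
        ((measurable_pathComp r t).comp (measurable_pi_iff.2 fun k => measurable_pi_apply _))
        (measurable_pi_apply _)
    have h3 := (hH 0).laplace_comp hY h2 hs
    -- The outermost process turns `s` into `s^ν`; the induction hypothesis there gives `(s^ν)^(ν^r)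
    -- = s^(ν^(r+1))`.
    have h4 := ih (fun k => hH k.succ) hind' (s := s ^ ν) (Real.rpow_nonneg hs ν)
    rw [← Real.rpow_mul hs, ← pow_succ'] at h4
    rw [← h4]
    refine Eq.trans (integral_congr_ae ?_) (h3.trans (integral_congr_ae ?_))
    · filter_upwards [hYeq] with ω hω
      rw [iterComp, hω]
    · filter_upwards [hYeq] with ω hω
      rw [hω]

/-- Induction over `S`: the new factor uses the paths in the row `{i} × Fin r`, the others those in
`S × Fin r`, and these blocks are disjoint. -/
lemma integral_prod_exp_neg_mul_pathComp {m r : ℕ} {ν : Fin m → ℝ}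
    {H : Fin m → Fin r → ℝ≥0 → Ω → ℝ≥0} (hH : ∀ j k, IsStableSubordinator (ν j) (H j k) P)
    (hind : iIndepFun (fun (p : Fin m × Fin r) (ω : Ω) (t : ℝ≥0) => H p.1 p.2 t ω) P) (t : ℝ≥0)
    (c : Fin m → ℝ) (S : Finset (Fin m)) :
    ∫ ω, ∏ j ∈ S, Real.exp (-c j * (pathComp r t (fun k s => H j k s ω) : ℝ)) ∂P
      = ∏ j ∈ S, ∫ ω, Real.exp (-c j * (pathComp r t (fun k s => H j k s ω) : ℝ)) ∂P := by
  induction S using Finset.induction_on with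
  | empty => simp
  | insert i S hi ih =>
    simp only [Finset.prod_insert hi]
    rw [← ih]
    have hdisj : Disjoint (({i} : Finset (Fin m)) ×ˢ (Finset.univ : Finset (Fin r)))
        (S ×ˢ (Finset.univ : Finset (Fin r))) :=
      Finset.disjoint_product.2 (Or.inl (Finset.disjoint_singleton_left.2 hi))
    have h1 := hind.indepFun_finset _ _ hdisj fun p => (hH p.1 p.2).measurable_path
    have hmeas : ∀ (T : Finset (Fin m × Fin r)) (j : Fin m) (hj : ∀ k, (j, k) ∈ T),
        Measurable fun p : (T → ℝ≥0 → ℝ≥0) =>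
          Real.exp (-c j * (pathComp r t (fun k => p ⟨(j, k), hj k⟩) : ℝ)) := by
      intro T j hj
      have : Measurable fun p : (T → ℝ≥0 → ℝ≥0) => pathComp r t (fun k => p ⟨(j, k), hj k⟩) :=
        (measurable_pathComp r t).comp (measurable_pi_iff.2 fun k => measurable_pi_apply _)
      fun_prop
    have hiT : ∀ k, (i, k) ∈ ({i} : Finset (Fin m)) ×ˢ (Finset.univ : Finset (Fin r)) := by simp
    have hST : ∀ (j : S) k, ((j : Fin m), k) ∈ S ×ˢ (Finset.univ : Finset (Fin r)) := by simp
    -- The product runs over `S.attach` because the functional has access only to coordinates in the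
    -- block, so each `j` must carry its membership proof.
    have h2 : IndepFun (fun ω => Real.exp (-c i * (pathComp r t (fun k s => H i k s ω) : ℝ)))
        (fun ω => ∏ j ∈ S.attach, Real.exp (-c j * (pathComp r t (fun k s => H j k s ω) : ℝ))) P :=
      h1.comp (φ := fun p : ((({i} : Finset (Fin m)) ×ˢ (Finset.univ : Finset (Fin r)) :
            Finset (Fin m × Fin r)) → ℝ≥0 → ℝ≥0) => Real.exp (-c i * (pathComp r t (fun k => p ⟨(i, k), hiT k⟩) : ℝ)))
        (ψ := fun p : ((S ×ˢ (Finset.univ : Finset (Fin r)) :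
            Finset (Fin m × Fin r)) → ℝ≥0 → ℝ≥0) => ∏ j ∈ S.attach,
          Real.exp (-c j * (pathComp r t (fun k => p ⟨(j, k), hST j k⟩) : ℝ)))
        (hmeas _ i hiT) (Finset.measurable_fun_prod _ fun j _ => hmeas _ j (hST j))
    have h3 : IndepFun (fun ω => Real.exp (-c i * (pathComp r t (fun k s => H i k s ω) : ℝ)))
        (fun ω => ∏ j ∈ S, Real.exp (-c j * (pathComp r t (fun k s => H j k s ω) : ℝ))) P := by
      convert h2 using 2 with ω
      exact (Finset.prod_attach S
        fun j => Real.exp (-c j * (pathComp r t (fun k s => H j k s ω) : ℝ))).symm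
    have hm' : ∀ j, Measurable fun ω =>
        Real.exp (-c j * (pathComp r t (fun k s => H j k s ω) : ℝ)) := fun j => by
      have := measurable_pathComp_comp (hH j) t
      fun_prop
    exact h3.integral_fun_mul_eq_mul_integral (hm' i).aestronglyMeasurable
      (Finset.measurable_fun_prod _ fun j _ => hm' j).aestronglyMeasurable

/-- The bridge from subordinators to the analytic part. The relation between `a` and `w` is what `(s
w)^(ν^r) = a s^(ν^r)` requires. -/
theorem hasLaplaceExponent_combProcess {m r : ℕ} {ν w a : Fin m → ℝ}
    {H : Fin m → Fin r → ℝ≥0 → Ω → ℝ≥0} (hH : ∀ j k, IsStableSubordinator (ν j) (H j k) P)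
    (hind : iIndepFun (fun (p : Fin m × Fin r) (ω : Ω) (t : ℝ≥0) => H p.1 p.2 t ω) P)
    (hw : ∀ j, 0 < w j) (ha : ∀ j, a j = w j ^ (ν j ^ r)) :
    HasLaplaceExponent a (fun j => ν j ^ r) (combProcess w H) P where
  aemeasurable t := by
    refine Finset.aemeasurable_fun_sum _ fun j _ => AEMeasurable.const_mul ?_ _
    refine ⟨fun ω => (pathComp r t (fun k s => H j k s ω) : ℝ),
      (measurable_pathComp_comp (hH j) t).coe_nnreal_real, ?_⟩
    filter_upwards [ae_pathComp_eq_iterComp (hH j) t] with ω hω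
    rw [hω]
  nonneg t ω := Finset.sum_nonneg fun j _ => mul_nonneg (hw j).le (NNReal.coe_nonneg _)
  start_zero := by
    filter_upwards [ae_all_iff.2 fun j => ae_all_iff.2 fun k => (hH j k).start_zero] with ω hω
    refine Finset.sum_eq_zero fun j _ => ?_
    rw [iterComp_zero_time (hω j), NNReal.coe_zero, mul_zero]
  monotone_paths := by
    filter_upwards [ae_all_iff.2 fun j => ae_all_iff.2 fun k => (hH j k).monotone_paths] with ω hω
    intro s t hst
    refine Finset.sum_le_sum fun j _ => mul_le_mul_of_nonneg_left ?_ (hw j).le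
    exact NNReal.coe_le_coe.2 (monotone_iterComp (hω j) hst)
  rightCont_paths := by
    filter_upwards [ae_all_iff.2 fun j => ae_all_iff.2 fun k => (hH j k).monotone_paths,
      ae_all_iff.2 fun j => ae_all_iff.2 fun k => (hH j k).rightCont_paths] with ω hmono hc t
    refine tendsto_finsetSum _ fun j _ => Tendsto.const_mul _ ?_
    exact (NNReal.continuous_coe.tendsto _).comp
      (continuousWithinAt_iterComp (hmono j) (hc j) t).tendsto
  laplace t s hs := by
    have h := integral_prod_exp_neg_mul_pathComp hH hind t (fun j => s * w j) Finset.univ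
    have e : ∀ j, ∫ ω, Real.exp (-(s * w j) * (pathComp r t (fun k s => H j k s ω) : ℝ)) ∂P
        = Real.exp (-(t : ℝ) * (a j * s ^ (ν j ^ r))) := by
      intro j
      have hj : iIndepFun (fun (k : Fin r) (ω : Ω) (t : ℝ≥0) => H j k t ω) P :=
        hind.precomp (g := fun k => (j, k)) fun k l hkl => by simpa using hkl
      rw [ha, mul_comm (w j ^ _), ← Real.mul_rpow hs.le (hw j).le,
        ← laplace_iterComp (hH j) hj t (mul_nonneg hs.le (hw j).le)]
      refine integral_congr_ae ?_
      filter_upwards [ae_pathComp_eq_iterComp (hH j) t] with ω hω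
      rw [hω]
    simp only [e, ← Real.exp_sum, ← Finset.mul_sum] at h
    rw [← h]
    refine integral_congr_ae ?_
    filter_upwards [ae_all_iff.2 fun j => ae_pathComp_eq_iterComp (hH j) t] with ω hω
    rw [combProcess, Finset.mul_sum]
    congr 1
    refine Finset.sum_congr rfl fun j _ => ?_
    rw [hω]
    ring

end Laplace

/-! ### The two choices of weights -/

theorem mainTheorem4 {Ω : Type*} [MeasurableSpace Ω] (P : Measure Ω) [IsProbabilityMeasure P]
    (m r : ℕ) (hm : 1 ≤ m) (hr : 1 ≤ r) (ν lam : Fin m → ℝ)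
    (hν : ∀ j, ν j ∈ Ioo (0 : ℝ) 1) (hlam : ∀ j, 0 < lam j)
    (H : Fin m → Fin r → ℝ≥0 → Ω → ℝ≥0)
    (hH : ∀ j k, IsStableSubordinator (ν j) (H j k) P)
    (hind : iIndepFun (fun (p : Fin m × Fin r) (ω : Ω) (t : ℝ≥0) => H p.1 p.2 t ω) P) :
    -- weights `lam j ^ (1 / ν j ^ r)`, coefficients `lam j`
    ((∃ h : ℝ → ℝ → ℝ,
        IsLawDensity P (combProcess (fun j => lam j ^ (1 / ν j ^ r)) H) h ∧
        SolvesSpaceFractional lam (fun j => ν j ^ r) h) ∧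
      (∃ l : ℝ → ℝ → ℝ,
        IsLawDensity P (inverseProcess (combProcess (fun j => lam j ^ (1 / ν j ^ r)) H)) l ∧
        SolvesTimeFractional lam (fun j => ν j ^ r) l)) ∧
    -- weights `lam j ^ (1 / ν j)`, coefficients `lam j ^ (ν j ^ (r - 1))`
    ((∃ h : ℝ → ℝ → ℝ,
        IsLawDensity P (combProcess (fun j => lam j ^ (1 / ν j)) H) h ∧
        SolvesSpaceFractional (fun j => lam j ^ (ν j ^ (r - 1))) (fun j => ν j ^ r) h) ∧
      (∃ l : ℝ → ℝ → ℝ,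
        IsLawDensity P (inverseProcess (combProcess (fun j => lam j ^ (1 / ν j)) H)) l ∧
        SolvesTimeFractional (fun j => lam j ^ (ν j ^ (r - 1))) (fun j => ν j ^ r) l)) := by
  have hα : ∀ j, ν j ^ r ∈ Ioo (0 : ℝ) 1 := fun j =>
    ⟨pow_pos (hν j).1 r, pow_lt_one₀ (hν j).1.le (hν j).2 (by omega)⟩
  have hw₁ : ∀ j, lam j = (lam j ^ (1 / ν j ^ r)) ^ (ν j ^ r) := fun j => by
    rw [← Real.rpow_mul (hlam j).le, one_div, inv_mul_cancel₀ (hα j).1.ne', Real.rpow_one]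
  -- Since `r ≥ 1`, the truncated `r - 1` is a true predecessor and `ν⁻¹ ν^r = ν^(r-1)`.
  have hw₂ : ∀ j, lam j ^ (ν j ^ (r - 1)) = (lam j ^ (1 / ν j)) ^ (ν j ^ r) := fun j => by
    obtain ⟨k, rfl⟩ : ∃ k, r = k + 1 := ⟨r - 1, by omega⟩
    rw [← Real.rpow_mul (hlam j).le, Nat.add_sub_cancel, pow_succ', one_div,
      inv_mul_cancel_left₀ (hν j).1.ne']
  have hX₁ := hasLaplaceExponent_combProcess hH hind (fun j => Real.rpow_pos_of_pos (hlam j) _) hw₁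
  have hX₂ := hasLaplaceExponent_combProcess hH hind (fun j => Real.rpow_pos_of_pos (hlam j) _) hw₂
  have hpos : ∀ j, 0 < lam j ^ (ν j ^ (r - 1)) := fun j => Real.rpow_pos_of_pos (hlam j) _
  exact ⟨⟨hX₁.exists_solvesSpaceFractional hm hlam hα, hX₁.exists_solvesTimeFractional hm hlam hα⟩,
    ⟨hX₂.exists_solvesSpaceFractional hm hpos hα, hX₂.exists_solvesTimeFractional hm hpos hα⟩⟩
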